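/- Let $S\subset\mathbb R^3$ be the sphere of radius $R>0$ centred at the origin, and for $X,Y\in S$ let $\angle(X,Y)\in[0,\pi]$ be the angular distance and $|XY|=R\,\angle(X,Y)$ the length of the shorter great-circle arc. A pursuer $P$ moves on $S$ with constant speed $v_P>0$, and an evader $E$ moves on $S$ with freely chosen direction and speed in $[0,\mu v_P]$, where $0<\mu<1$; the evader's motion is any path $t\mapsto E(t)$, $t\ge 0$, that is Lipschitz with constant $\mu v_P$. The Apollonius domain of a position $(P,E)$ is $$\mathcal A(P,E)=\Big\{I\in S:\ \frac{|IE|}{\mu v_P}\le\frac{|IP|}{v_P}\Big\}.$$ The geodesic parallel strategy of the pursuer is the following. At (almost) every time $t$ before capture, if $w=\dot E(t)$ is the evader's current velocity, let $I$ be the point, on the great circle through $E(t)$ in the direction of $w$, at which an evader continuing from $E(t)$ along that great circle with constant speed $\|w\|$ and a pursuer going from $P(t)$ along a shortest arc with speed $v_P$ arrive simultaneously, that is, $|IE(t)|=\|w\|\tau$ and $|IP(t)|=v_P\tau$ for some $\tau\ge 0$ (if $w=0$, then $I=E(t)$); the pursuer's velocity $\dot P(t)$ has length $v_P$ and points along the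 shortest arc from $P(t)$ to $I$. If the evader moves at its maximal speed $\mu v_P$, then $I$ is the boundary point of $\mathcal A(P(t),E(t))$ associated with the evader's current heading. Let $P_0\neq E_0$ be initial positions on $S$, let $\alpha=\angle(P_0,E_0)$, and let $\mathcal T\subseteq S$ be a target set. Suppose that $$\mathcal A(P_0,E_0)\cap\mathcal T=\varnothing\qquad\text{and}\qquad \alpha\le\frac{1-\mu}{1+\mu}\,\pi .$$ Then the pursuer wins the target-guarding game by using the geodesic parallel strategy. Precisely, there is a finite time $t_{\max}$, which does not depend on the evader's motion, such that for every evader motion $E$ with $E(0)=E_0$ there is a pursuer motion $P$ with $P(0)=P_0$ that follows the geodesic parallel strategy against $E$, and for every such $P$ there is a first time $t_c\le t_{\max}$ with $P(t_c)=E(t_c)$ (capture), and 1. $E(t)\notin\mathcal T$ for all $0\le t\le t_c$; 2. $\mathcal A(P(t),E(t))\subseteq\mathcal A(P(s),E(s))$ for all $0\le s\le t\le t_c$. -/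

import Mathlib

open MeasureTheory Set

noncomputable section

/-- Ambient Euclidean space. Positions are vectors of norm `R`, velocities are tangent vectors. -/
abbrev E3 := EuclideanSpace ℝ (Fin 3)

/-- Angular distance of two points of a sphere centred at the origin, a number in `[0, π]`. -/
def angDist (x y : E3) : ℝ := InnerProductGeometry.angle x y

/-- Length of the (shorter) great-circle arc between two points of the sphere of radius `R`. -/
def arcLen (R : ℝ) (x y : E3) : ℝ := R * angDist x y

/-- The Apollonius domain of the configuration with pursuer at `P` and evader at `E`: the points of
the sphere which the evader, at its maximal speed `μ * vP`, reaches no later than the pursuer. -/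
def apolloniusDomain (R vP μ : ℝ) (P E : E3) : Set E3 :=
  {I | I ∈ Metric.sphere (0 : E3) R ∧ arcLen R I E / (μ * vP) ≤ arcLen R I P / vP}

/-- Position at time `τ` of a point that starts at `x`, with velocity `w` tangent to the sphere of
radius `R`, and moves along a great circle with constant speed `‖w‖` (it rests at `x` if `w = 0`). -/
def geodesicPoint (R : ℝ) (x w : E3) (τ : ℝ) : E3 :=
  Real.cos (‖w‖ * τ / R) • x + (R * Real.sin (‖w‖ * τ / R) / ‖w‖) • w

/-- `I` is the point, reached after time `τ`, at which an evader moving from `E` along a great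
circle with its current velocity `w` and a pursuer moving from `P` with speed `vP` along a shortest
arc arrive simultaneously. -/
def IsInterceptPoint (R vP : ℝ) (P E w I : E3) (τ : ℝ) : Prop :=
  0 ≤ τ ∧ I = geodesicPoint R E w τ ∧ arcLen R I E = ‖w‖ * τ ∧ arcLen R I P = vP * τ

/-- If the evader's current speed is maximal, the intercept point is the point of the Apollonius
domain, in the direction of the evader's heading, that both players reach simultaneously. -/
theorem IsInterceptPoint.mem_apolloniusDomain {R vP μ : ℝ} (hR : 0 ≤ R) (hv : 0 < vP) (hμ : 0 < μ)
    {P E w I : E3} {τ : ℝ} (hE : ‖E‖ = R) (hwE : inner ℝ w E = 0) (hw : ‖w‖ = μ * vP)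
    (h : IsInterceptPoint R vP P E w I τ) :
    I ∈ apolloniusDomain R vP μ P E ∧ arcLen R I E / (μ * vP) = arcLen R I P / vP := by
  obtain ⟨_, h1, h2, h3⟩ := h
  have hmv : 0 < μ * vP := mul_pos hμ hv
  have he : arcLen R I E / (μ * vP) = arcLen R I P / vP := by
    rw [h2, h3, hw, mul_div_cancel_left₀ _ hmv.ne', mul_div_cancel_left₀ _ hv.ne']
  refine ⟨⟨?_, he.le⟩, he⟩
  rw [mem_sphere_zero_iff_norm, h1, ← sq_eq_sq₀ (norm_nonneg _) hR, geodesicPoint,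
    norm_add_sq_real, norm_smul, norm_smul, real_inner_smul_left, real_inner_smul_right,
    real_inner_comm, hwE, hE, hw]
  simp only [Real.norm_eq_abs, mul_pow, sq_abs, div_pow, mul_zero, add_zero]
  field_simp
  nlinarith [Real.sin_sq_add_cos_sq (μ * vP * τ / R)]

/-- `v` is the pursuer's velocity prescribed by the geodesic parallel strategy when the players are
at `P` and `E` and the evader's current velocity is `w`: it has length `vP`, is tangent to the
sphere, and points along the shortest arc from `P` to the intercept point. -/
def IsGeodesicParallelVelocity (R vP : ℝ) (P E w v : E3) : Prop :=
  ‖v‖ = vP ∧ inner ℝ v P = 0 ∧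
    ∃ (I : E3) (τ : ℝ), IsInterceptPoint R vP P E w I τ ∧ geodesicPoint R P v τ = I

/-- A motion `X` on the sphere of radius `R` over times `t ≥ 0` that starts at `X₀` and has speed at
most `c`. Being Lipschitz, it is absolutely continuous and almost everywhere differentiable, with
tangent velocity of length at most `c`; direction and speed are otherwise arbitrary. -/
structure IsMotion (R c : ℝ) (X₀ : E3) (X : ℝ → E3) : Prop where
  init : X 0 = X₀
  mem : ∀ t, 0 ≤ t → X t ∈ Metric.sphere (0 : E3) R
  lip : ∀ s t, 0 ≤ s → s ≤ t → dist (X s) (X t) ≤ c * (t - s)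

/-- The pursuer's motion `P` results from the geodesic parallel strategy against the evader's motion
`E`: at almost every time before capture its velocity is the prescribed one. (What the pursuer
does after capture is irrelevant.) -/
structure IsGeodesicParallelResponse (R vP : ℝ) (P₀ : E3) (E P : ℝ → E3) : Prop where
  motion : IsMotion R vP P₀ P
  strategy : ∀ᵐ t : ℝ, 0 < t → (∀ s ∈ Icc 0 t, P s ≠ E s) →
    ∃ w v : E3, HasDerivAt E w t ∧ HasDerivAt P v t ∧
      IsGeodesicParallelVelocity R vP (P t) (E t) w v

/-- `tc` is the capture time: the first time at which the players are at the same point. -/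
def IsCaptureTime (P E : ℝ → E3) (tc : ℝ) : Prop :=
  0 ≤ tc ∧ P tc = E tc ∧ ∀ s, 0 ≤ s → s < tc → P s ≠ E s

end

noncomputable section

open Filter Topology InnerProductGeometry

/-! ### Trigonometric inequalities -/

/-! Scale to the unit sphere and unit pursuer speed. A point `x` lies in the Apollonius domain
exactly when `angle x e ≤ μ * angle x p`, so the domain shrinks as soon as no outside point can
enter it. This comes from a differential inequality, `UnitIntercept.ratio_rate`: if the ratio `m =
angle x e / angle x p` is at least the evader's relative speed and `angle p e ≤ (1 - m) / (1 + m) *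
π`, the ratio does not decrease. Expressed through the cosine of the distance from `x` to the
intercept point, the claim is affine in that cosine, and the worst case is the largest value the
triangle inequality permits. What remains is concavity of the cosine together with
`mul_sinc_le_sinc`, which rests on Euler's product for the sine.

The angular condition persists because the players approach: `closingRate_ge` makes their distance
shrink at least at a constant rate, which also bounds the capture time independently of the evader.
The strict decrease leaves room for ratios slightly above `μ` at positive times, which is what
`UnitPursuit.lt_of_lt` needs. Motions are only Lipschitz; absolute continuity turns signs of almost
everywhere derivatives into monotonicity.

A motion following the strategy exists because the prescribed velocity is measurable in time and
continuous in the pursuer's position until capture, so that Euler polygons have a subsequence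
converging to a solution. Finally, the evader always lies in its own Apollonius domain, hence in the
initial one, which misses the target. -/

theorem tendsto_prod_sinc (x : ℝ) :
    Tendsto (fun n : ℕ => ∏ j ∈ Finset.range n, (1 - x ^ 2 / ((j : ℝ) + 1) ^ 2)) atTop
      (𝓝 (Real.sinc (Real.pi * x))) := by
  rcases eq_or_ne x 0 with rfl | hx
  · simp
  · have h := Real.tendsto_euler_sin_prod x
    have hpx : Real.pi * x ≠ 0 := mul_ne_zero Real.pi_ne_zero hx
    rw [Real.sinc_of_ne_zero hpx]
    refine (h.div_const (Real.pi * x)).congr fun n => ?_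
    rw [mul_div_cancel_left₀ _ hpx]

/-- The quotient of the factors `2 * N + 1 ± (x - y)` tends to 1, and with them both sides agree for
every `N` when `x + y = 1`. Accordingly the gain in the induction step is a multiple of `1 - (x +
y)`. -/
theorem prod_sinc_comparison {x y : ℝ} (hy : 0 ≤ y) (hyx : y ≤ x) (hxy : x + y ≤ 1) (N : ℕ) :
    (∏ j ∈ Finset.range N, (1 - y ^ 2 / ((j : ℝ) + 1) ^ 2)) * (1 - (x - y)) *
        (2 * N + 1 + (x - y)) ≤
      (∏ j ∈ Finset.range N, (1 - x ^ 2 / ((j : ℝ) + 1) ^ 2)) * (1 + (x - y)) *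
        (2 * N + 1 - (x - y)) := by
  induction N with
  | zero => simp; nlinarith
  | succ N ih =>
    rw [Finset.prod_range_succ, Finset.prod_range_succ]
    have hPy : 0 ≤ ∏ j ∈ Finset.range N, (1 - y ^ 2 / ((j : ℝ) + 1) ^ 2) := by
      refine Finset.prod_nonneg fun j _ => ?_
      have hj : (0 : ℝ) ≤ j := Nat.cast_nonneg j
      rw [sub_nonneg, div_le_one (by positivity)]
      nlinarith
    generalize (∏ j ∈ Finset.range N, (1 - y ^ 2 / ((j : ℝ) + 1) ^ 2)) = A at *
    generalize (∏ j ∈ Finset.range N, (1 - x ^ 2 / ((j : ℝ) + 1) ^ 2)) = B at *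
    push_cast
    have hN : (0 : ℝ) ≤ N := Nat.cast_nonneg N
    set n : ℝ := (N : ℝ) + 1 with hn
    have hn1 : 1 ≤ n := by linarith
    have hx1 : x ≤ 1 := by linarith
    have hN' : (N : ℝ) = n - 1 := by linarith
    rw [hN'] at ih
    have key : (n ^ 2 - y ^ 2) * ((2 * n + 1 + (x - y)) * (2 * n - 1 - (x - y))) ≤
        (n ^ 2 - x ^ 2) * ((2 * n - 1 + (x - y)) * (2 * n + 1 - (x - y))) := by
      have h1 : 0 ≤ (x - y) * (1 - (x + y)) * (4 * n ^ 2 + (x + y) - (x - y) ^ 2) := by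
        refine mul_nonneg (mul_nonneg (by linarith) (by linarith)) ?_
        nlinarith
      nlinarith
    have hxn : 0 ≤ n ^ 2 - x ^ 2 := by nlinarith
    -- The induction step cancels this factor, which vanishes only for `n = 1`, `x = 1`, `y = 0`;
    -- both sides are then zero.
    have hpos : 0 < 2 * n - 1 - (x - y) ∨ 2 * n - 1 - (x - y) = 0 := by
      rcases (show 0 ≤ 2 * n - 1 - (x - y) by linarith).lt_or_eq with h | h
      · exact Or.inl h
      · exact Or.inr h.symm
    have e1 : 1 - y ^ 2 / n ^ 2 = (n ^ 2 - y ^ 2) / n ^ 2 := by field_simp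
    have e2 : 1 - x ^ 2 / n ^ 2 = (n ^ 2 - x ^ 2) / n ^ 2 := by field_simp
    rw [e1, e2]
    rcases hpos with hpos | hz
    · refine le_of_mul_le_mul_right ?_ hpos
      have s1 : A * ((n ^ 2 - y ^ 2) / n ^ 2) * (1 - (x - y)) * (2 * n + 1 + (x - y)) *
          (2 * n - 1 - (x - y)) = A * (1 - (x - y)) / n ^ 2 *
          ((n ^ 2 - y ^ 2) * ((2 * n + 1 + (x - y)) * (2 * n - 1 - (x - y)))) := by ring
      have s2 : B * ((n ^ 2 - x ^ 2) / n ^ 2) * (1 + (x - y)) * (2 * n + 1 - (x - y)) *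
          (2 * n - 1 - (x - y)) = ((n ^ 2 - x ^ 2) / n ^ 2 * (2 * n + 1 - (x - y))) *
          (B * (1 + (x - y)) * (2 * (n - 1) + 1 - (x - y))) := by ring
      have s3 : A * (1 - (x - y)) / n ^ 2 *
          ((n ^ 2 - x ^ 2) * ((2 * n - 1 + (x - y)) * (2 * n + 1 - (x - y)))) =
          ((n ^ 2 - x ^ 2) / n ^ 2 * (2 * n + 1 - (x - y))) *
          (A * (1 - (x - y)) * (2 * (n - 1) + 1 + (x - y))) := by ring
      rw [s1, s2]
      refine (mul_le_mul_of_nonneg_left key ?_).trans ?_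
      · exact div_nonneg (mul_nonneg hPy (by linarith)) (by positivity)
      · rw [s3]
        refine mul_le_mul_of_nonneg_left ih (mul_nonneg (div_nonneg hxn (by positivity)) ?_)
        linarith
    · have hn' : n = 1 := by linarith
      have hd : x - y = 1 := by linarith
      have hx' : x = 1 := by linarith
      have hy' : y = 0 := by linarith
      subst hx' hy'
      rw [hn']
      norm_num

theorem sinc_comparison {x y : ℝ} (hy : 0 ≤ y) (hyx : y ≤ x) (hxy : x + y ≤ 1) :
    Real.sinc (Real.pi * y) * (1 - (x - y)) ≤ Real.sinc (Real.pi * x) * (1 + (x - y)) := by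
  have hlim : ∀ c : ℝ, Tendsto (fun n : ℕ => (2 * (n : ℝ) + 1 + c) / (2 * n + 1)) atTop
      (𝓝 1) := by
    intro c
    have h0 : Tendsto (fun n : ℕ => c / (2 * (n : ℝ) + 1)) atTop (𝓝 0) :=
      tendsto_const_nhds.div_atTop
        (tendsto_atTop_add_const_right _ _ (tendsto_natCast_atTop_atTop.const_mul_atTop two_pos))
    have h1 := h0.const_add 1
    rw [add_zero] at h1
    refine h1.congr fun n => ?_
    have : (0 : ℝ) < 2 * n + 1 := by positivity
    field_simp
  have hy1 := ((tendsto_prod_sinc y).mul_const (1 - (x - y))).mul (hlim (x - y))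
  have hx1 := ((tendsto_prod_sinc x).mul_const (1 + (x - y))).mul (hlim (-(x - y)))
  rw [mul_one] at hy1 hx1
  refine le_of_tendsto_of_tendsto' hy1 hx1 fun n => ?_
  have hn : (0 : ℝ) < 2 * n + 1 := by positivity
  rw [← mul_div_assoc, ← mul_div_assoc]
  have h := prod_sinc_comparison hy hyx hxy n
  rw [sub_eq_add_neg (2 * (n : ℝ) + 1)] at h
  exact div_le_div_of_nonneg_right h hn.le

theorem sinc_nonneg {x : ℝ} (h0 : 0 ≤ x) (h : x ≤ Real.pi) : 0 ≤ Real.sinc x := by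
  rcases h0.eq_or_lt with rfl | h0
  · simp
  · rw [Real.sinc_of_ne_zero h0.ne']
    exact div_nonneg (Real.sin_nonneg_of_nonneg_of_le_pi h0.le h) h0.le

theorem sinc_pos {x : ℝ} (h0 : 0 ≤ x) (h : x < Real.pi) : 0 < Real.sinc x := by
  rcases h0.eq_or_lt with rfl | h0
  · simp
  · rw [Real.sinc_of_ne_zero h0.ne']
    exact div_pos (Real.sin_pos_of_pos_of_lt_pi h0 h) h0

theorem mul_sinc (x : ℝ) : x * Real.sinc x = Real.sin x := by
  rcases eq_or_ne x 0 with rfl | hx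
  · simp
  · rw [Real.sinc_of_ne_zero hx]; field_simp

/-- The time to interception is bounded by a multiple of the initial distance. -/
theorem one_add_mul_le_pi {μ ν τ : ℝ} (hν : 0 ≤ ν) (hνμ : ν ≤ μ) (hμ : μ < 1)
    (h : (1 - ν) * τ ≤ (1 - μ) / (1 + μ) * Real.pi) : (1 + μ) * τ ≤ Real.pi := by
  rcases le_or_gt τ 0 with h0 | h0
  · nlinarith [Real.pi_pos]
  · have h1 : (1 - μ) * τ ≤ (1 - μ) / (1 + μ) * Real.pi := by nlinarith
    have h2 : (1 - μ) / (1 + μ) * Real.pi = (1 - μ) * (Real.pi / (1 + μ)) := by ring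
    rw [h2] at h1
    have h3 := le_of_mul_le_mul_left h1 (by linarith)
    rw [le_div_iff₀ (by linarith)] at h3
    linarith

/-- With `D = (1 - ν) * τ / π` the last hypothesis says exactly `m * (1 + D) ≤ 1 - D`, and
`sinc_comparison` trades these two factors for the two values of `sinc`. -/
theorem mul_sinc_le_sinc {m ν τ : ℝ} (hν : 0 ≤ ν) (hνm : ν ≤ m) (hm : m < 1) (hτ : 0 ≤ τ)
    (h : (1 - ν) * τ ≤ (1 - m) / (1 + m) * Real.pi) :
    m * Real.sinc (ν * τ) ≤ Real.sinc τ := by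
  have hpi := Real.pi_pos
  have hs := one_add_mul_le_pi hν hνm hm h
  have e1 : Real.pi * (τ / Real.pi) = τ := by field_simp
  have e2 : Real.pi * (ν * τ / Real.pi) = ν * τ := by field_simp
  have key := sinc_comparison (x := τ / Real.pi) (y := ν * τ / Real.pi) (by positivity)
    (div_le_div_of_nonneg_right (by nlinarith) hpi.le)
    (by rw [← add_div, div_le_one hpi]; nlinarith)
  rw [e1, e2] at key
  set D := τ / Real.pi - ν * τ / Real.pi with hD
  have hD' : D = (1 - ν) * τ / Real.pi := by rw [hD]; ring
  have hD0 : 0 ≤ D := by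
    rw [hD']; exact div_nonneg (mul_nonneg (by linarith) hτ) hpi.le
  have hDk : D ≤ (1 - m) / (1 + m) := by
    rw [hD', div_le_iff₀ hpi]; exact h
  rw [le_div_iff₀ (by linarith)] at hDk
  have hsn : 0 ≤ Real.sinc (ν * τ) := sinc_nonneg (by positivity) (by nlinarith)
  have h1 : m * (1 + D) ≤ 1 - D := by linarith
  refine le_of_mul_le_mul_right ?_ (show 0 < 1 + D by linarith)
  calc m * Real.sinc (ν * τ) * (1 + D) = Real.sinc (ν * τ) * (m * (1 + D)) := by ring
    _ ≤ Real.sinc (ν * τ) * (1 - D) := mul_le_mul_of_nonneg_left h1 hsn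
    _ ≤ _ := key

theorem sin_mul_le_sin {m a : ℝ} (hm0 : 0 ≤ m) (hm : m ≤ 1) (ha : 0 ≤ a)
    (h : (1 + m) * a ≤ Real.pi) : Real.sin (m * a) ≤ Real.sin a := by
  rw [← sub_nonneg, Real.sin_sub_sin]
  have h1 : 0 ≤ Real.sin ((a - m * a) / 2) :=
    Real.sin_nonneg_of_nonneg_of_le_pi (by nlinarith) (by nlinarith)
  have h2 : 0 ≤ Real.cos ((a + m * a) / 2) :=
    Real.cos_nonneg_of_neg_pi_div_two_le_of_le (by nlinarith [Real.pi_pos]) (by nlinarith)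
  positivity

/-- The absolute value allows a product `cos τ * cos a` to be bounded whatever the signs of its
factors. -/
theorem abs_cos_le_cos_mul {m a : ℝ} (hm0 : 0 ≤ m) (hm : m ≤ 1) (ha : 0 ≤ a)
    (h : (1 + m) * a ≤ Real.pi) : |Real.cos a| ≤ Real.cos (m * a) := by
  rw [abs_le]
  constructor
  · rw [neg_le_iff_add_nonneg', Real.cos_add_cos]
    have h1 : 0 ≤ Real.cos ((m * a + a) / 2) :=
      Real.cos_nonneg_of_neg_pi_div_two_le_of_le (by nlinarith [Real.pi_pos]) (by nlinarith)
    have h2 : 0 ≤ Real.cos ((m * a - a) / 2) :=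
      Real.cos_nonneg_of_neg_pi_div_two_le_of_le (by nlinarith [Real.pi_pos])
        (by nlinarith [Real.pi_pos])
    exact mul_nonneg (mul_nonneg two_pos.le h1) h2
  · refine Real.cos_le_cos_of_nonneg_of_le_pi (by positivity) (by nlinarith) (by nlinarith)

/-- After division by `m`, the left side is affine in `ν` and the right side concave on `[0, m]`. It
therefore suffices to compare at `ν = 0`, where `cos τ * cos a ≤ cos (m * a)`, and at `ν = m`, where
`cos (τ - a) ≤ cos (m * (τ - a))`. -/
theorem cos_concavity_bound {m ν a τ : ℝ} (hν : 0 ≤ ν) (hνm : ν ≤ m) (hm0 : 0 < m) (hm : m < 1)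
    (ha : 0 ≤ a) (hτ : 0 ≤ τ) (ham : (1 + m) * a ≤ Real.pi) (hτm : (1 + m) * τ ≤ Real.pi) :
    m * (Real.cos τ * Real.cos a) + ν * (Real.sin τ * Real.sin a) ≤
      m * Real.cos (m * a - ν * τ) := by
  have hpi := Real.pi_pos
  have hma : m * a ≤ Real.pi / 2 := by nlinarith
  have hmτ : m * τ ≤ Real.pi / 2 := by nlinarith
  have hma0 : 0 ≤ m * a := by positivity
  have hmτ0 : 0 ≤ m * τ := by positivity
  have ht0 : 0 ≤ ν / m := by positivity
  have ht1 : ν / m ≤ 1 := (div_le_one hm0).2 hνm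
  have hconc := strictConcaveOn_cos_Icc.concaveOn.2
    (show m * a ∈ Icc (-(Real.pi / 2)) (Real.pi / 2) from ⟨by linarith, by linarith⟩)
    (show m * a - m * τ ∈ Icc (-(Real.pi / 2)) (Real.pi / 2) from ⟨by linarith, by linarith⟩)
    (show 0 ≤ 1 - ν / m by linarith) ht0 (by ring)
  simp only [smul_eq_mul] at hconc
  have e : (1 - ν / m) * (m * a) + ν / m * (m * a - m * τ) = m * a - ν * τ := by
    field_simp; ring
  rw [e] at hconc
  have h1 : Real.cos τ * Real.cos a ≤ Real.cos (m * a) := by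
    refine le_trans ?_ (abs_cos_le_cos_mul hm0.le hm.le ha ham)
    refine (le_abs_self _).trans ?_
    rw [abs_mul]
    exact mul_le_of_le_one_left (abs_nonneg _) (Real.abs_cos_le_one _)
  have h2 : Real.cos τ * Real.cos a + Real.sin τ * Real.sin a ≤ Real.cos (m * a - m * τ) := by
    rw [← Real.cos_sub, ← mul_sub, ← Real.cos_abs (τ - a), ← Real.cos_abs (m * (a - τ)), abs_mul,
      abs_of_pos hm0, abs_sub_comm τ a]
    have hpa : |a - τ| ≤ Real.pi := by
      rw [abs_le]; constructor <;> nlinarith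
    refine Real.cos_le_cos_of_nonneg_of_le_pi (by positivity) hpa ?_
    nlinarith [abs_nonneg (a - τ)]
  have h3 : Real.cos τ * Real.cos a + ν / m * (Real.sin τ * Real.sin a) ≤
      Real.cos (m * a - ν * τ) := by
    refine le_trans ?_ hconc
    have := mul_le_mul_of_nonneg_left h1 (show 0 ≤ 1 - ν / m by linarith)
    have := mul_le_mul_of_nonneg_left h2 ht0
    nlinarith
  have h4 := mul_le_mul_of_nonneg_left h3 hm0.le
  have e2 : m * (Real.cos τ * Real.cos a + ν / m * (Real.sin τ * Real.sin a)) =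
      m * (Real.cos τ * Real.cos a) + ν * (Real.sin τ * Real.sin a) := by field_simp
  rwa [e2] at h4

/-- The scalar inequality behind the monotonicity of the ratio of the distances from a fixed point
to evader and pursuer. -/
theorem ratio_inequality {m ν a τ c : ℝ} (hν : 0 ≤ ν) (hνm : ν ≤ m) (hm0 : 0 < m) (hm : m < 1)
    (ha : 0 < a) (hτ : 0 < τ) (ham : (1 + m) * a ≤ Real.pi)
    (hτν : (1 - ν) * τ ≤ (1 - m) / (1 + m) * Real.pi) (hc : c ≤ Real.cos (m * a - ν * τ)) :
    (c - Real.cos (ν * τ) * Real.cos (m * a)) / (τ * Real.sinc (ν * τ)) / Real.sin (m * a) ≤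
      m * ((c - Real.cos τ * Real.cos a) / Real.sin τ / Real.sin a) := by
  have hpi := Real.pi_pos
  have hτm := one_add_mul_le_pi hν hνm hm hτν
  have hma0 : 0 < m * a := by positivity
  have hmτ0 : 0 < m * τ := by positivity
  have hντ : ν * τ ≤ m * τ := mul_le_mul_of_nonneg_right hνm hτ.le
  have hντ0 : 0 ≤ ν * τ := by positivity
  have hsτ : 0 < Real.sin τ := Real.sin_pos_of_pos_of_lt_pi hτ (by linarith)
  have hsa : 0 < Real.sin a := Real.sin_pos_of_pos_of_lt_pi ha (by linarith)
  have hsb : 0 < Real.sin (m * a) := Real.sin_pos_of_pos_of_lt_pi hma0 (by linarith)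
  have hS : 0 < τ * Real.sinc (ν * τ) := mul_pos hτ (sinc_pos hντ0 (by linarith))
  have hνS : ν * (τ * Real.sinc (ν * τ)) = Real.sin (ν * τ) := by
    rw [← mul_assoc, mul_sinc]
  have hmS : m * (τ * Real.sinc (ν * τ)) ≤ Real.sin τ := by
    rw [← mul_sinc τ]
    have := mul_le_mul_of_nonneg_left (mul_sinc_le_sinc hν hνm hm hτ.le hτν) hτ.le
    linarith
  have hab := sin_mul_le_sin hm0.le hm.le ha.le ham
  have hconc := cos_concavity_bound hν hνm hm0 hm ha.le hτ.le ham hτm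
  have hcos : Real.cos (m * a - ν * τ) =
      Real.cos (m * a) * Real.cos (ν * τ) + Real.sin (m * a) * Real.sin (ν * τ) :=
    Real.cos_sub _ _
  generalize τ * Real.sinc (ν * τ) = S at *
  rw [← hνS] at hcos
  generalize Real.cos (m * a - ν * τ) = D at *
  generalize Real.sin (m * a) = sb at *
  generalize Real.cos (m * a) = cb at *
  generalize Real.cos (ν * τ) = cβ at *
  generalize Real.sin τ = st at *
  generalize Real.cos τ = ct at *
  generalize Real.sin a = sa at *
  generalize Real.cos a = ca at *
  -- Both sides are affine in `c`, and by `h1` the left one has the larger slope, so the worst case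
  -- is `c = D`. There the left side equals `ν`, and `cos_concavity_bound` says that the right side
  -- is at least `ν`.
  rw [div_div, div_div, mul_div_assoc', div_le_div_iff₀ (by positivity) (by positivity)]
  have h1 : m * S * sb ≤ st * sa := mul_le_mul hmS hab hsb.le hsτ.le
  have h2 : 0 ≤ (D - c) * (st * sa - m * S * sb) :=
    mul_nonneg (by linarith) (by linarith)
  have h3 : 0 ≤ (m * D - (m * (ct * ca) + ν * (st * sa))) * (S * sb) :=
    mul_nonneg (by linarith) (by positivity)
  have h4 : D - cβ * cb = sb * (ν * S) := by rw [hcos]; ring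
  have h5 : (c - cβ * cb) = (sb * (ν * S)) - (D - c) := by linarith
  rw [h5]
  nlinarith

/-- Rate of change of the cosine of the distance `α` of the players: `C = cos α`, evader speed `ν`,
time `τ` to interception. -/
def closingRate (C ν τ : ℝ) : ℝ :=
  (Real.cos (ν * τ) - C * Real.cos τ) / Real.sin τ +
    (Real.cos τ - C * Real.cos (ν * τ)) / (τ * Real.sinc (ν * τ))

/-- The rate is affine in `C`. At `C = cos u` with `u = (1 - ν) * τ`, the case of an evader fleeing
straight away, it equals `(1 - ν) * sin u = (1 - ν) * tan (u / 2) * (1 + cos u)`. The bound is the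
line through this value that vanishes at `C = -1`, so only slopes have to be compared. -/
theorem closingRate_lower_bound {C ν τ : ℝ} (hν : 0 ≤ ν) (hν1 : ν < 1) (hτ : 0 < τ)
    (hτpi : τ < Real.pi) (hs : (1 + ν) * τ ≤ Real.pi) (hC : C ≤ Real.cos ((1 - ν) * τ)) :
    (1 - ν) * Real.tan ((1 - ν) * τ / 2) * (1 + C) ≤ closingRate C ν τ := by
  have hντ0 : 0 ≤ ν * τ := by positivity
  have hsτ : 0 < Real.sin τ := Real.sin_pos_of_pos_of_lt_pi hτ hτpi
  have hS : 0 < τ * Real.sinc (ν * τ) := mul_pos hτ (sinc_pos hντ0 (by nlinarith))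
  have hνS : ν * (τ * Real.sinc (ν * τ)) = Real.sin (ν * τ) := by
    rw [← mul_assoc, mul_sinc]
  set u := (1 - ν) * τ with hu
  have hu0 : 0 < u := mul_pos (by linarith) hτ
  have hcu : 0 < Real.cos (u / 2) :=
    Real.cos_pos_of_mem_Ioo ⟨by linarith, by nlinarith⟩
  have hsv : 0 ≤ Real.sin (τ + ν * τ) :=
    Real.sin_nonneg_of_nonneg_of_le_pi (by linarith) (by linarith)
  have hcv : 0 ≤ Real.cos (τ - u / 2) :=
    Real.cos_nonneg_of_neg_pi_div_two_le_of_le (by nlinarith) (by nlinarith)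
  rw [Real.sin_add] at hsv
  rw [Real.cos_sub] at hcv
  have hcosu : Real.cos u = Real.cos τ * Real.cos (ν * τ) + Real.sin τ * Real.sin (ν * τ) := by
    rw [← Real.cos_sub, hu]; ring_nf
  have hsinu : Real.sin u = Real.sin τ * Real.cos (ν * τ) - Real.cos τ * Real.sin (ν * τ) := by
    rw [← Real.sin_sub, hu]; ring_nf
  have ht : Real.tan (u / 2) * (1 + Real.cos u) = Real.sin u := by
    have e1 : Real.sin u = 2 * Real.sin (u / 2) * Real.cos (u / 2) := by
      rw [← Real.sin_two_mul]; ring_nf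
    have e2 : Real.cos u = 2 * Real.cos (u / 2) ^ 2 - 1 := by
      rw [← Real.cos_two_mul]; ring_nf
    rw [e1, e2, Real.tan_eq_sin_div_cos]
    field_simp
    ring
  -- This is `cos (τ - u / 2) / cos (u / 2)`, and `τ - u / 2 = (1 + ν) * τ / 2` is at most `π / 2`.
  have hct : 0 ≤ Real.cos τ + Real.sin τ * Real.tan (u / 2) := by
    rw [Real.tan_eq_sin_div_cos]
    have : Real.cos τ + Real.sin τ * (Real.sin (u / 2) / Real.cos (u / 2)) =
      (Real.cos τ * Real.cos (u / 2) + Real.sin τ * Real.sin (u / 2)) / Real.cos (u / 2) := by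
      field_simp
    rw [this]
    exact div_nonneg hcv hcu.le
  have hpy1 := Real.sin_sq_add_cos_sq τ
  have hpy2 := Real.sin_sq_add_cos_sq (ν * τ)
  unfold closingRate
  generalize Real.tan (u / 2) = T at *
  generalize τ * Real.sinc (ν * τ) = S at *
  generalize Real.cos u = cu at *
  generalize Real.sin u = su at *
  generalize Real.sin (ν * τ) = sβ at *
  subst hνS
  generalize Real.cos (ν * τ) = cβ at *
  generalize Real.sin τ = st at *
  generalize Real.cos τ = ct at *
  have e : (cβ - C * ct) / st + (ct - C * cβ) / S = (1 - ν) * su +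
      (cu - C) * ((ν * S * ct + cβ * st) + (1 - ν) * S * ct) / (S * st) := by
    rw [hsinu, hcosu]
    field_simp
    linear_combination (-cβ * S) * hpy1 - (ct * st) * hpy2
  have e' : (1 - ν) * T * (1 + C) = (1 - ν) * su - (cu - C) * ((1 - ν) * T) := by
    rw [← ht]; ring
  rw [e, e']
  have h1 : -((1 - ν) * T) ≤ ((ν * S * ct + cβ * st) + (1 - ν) * S * ct) / (S * st) := by
    rw [le_div_iff₀ (by positivity)]
    have := mul_nonneg (mul_nonneg (show 0 ≤ 1 - ν by linarith) hS.le) hct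
    nlinarith
  have h2 := mul_le_mul_of_nonneg_left h1 (show 0 ≤ cu - C by linarith)
  rw [mul_div_assoc]
  linarith

/-- Under the angular condition the players approach at a rate at least proportional to `α`. -/
theorem closingRate_ge {μ ν τ α : ℝ} (hμ0 : 0 < μ) (hν : 0 ≤ ν) (hνμ : ν ≤ μ) (hμ : μ < 1) (hτ : 0 < τ)
    (h1 : (1 - ν) * τ ≤ α) (h2 : α ≤ (1 + ν) * τ)
    (hα : α ≤ (1 - μ) / (1 + μ) * Real.pi) :
    (1 - μ) ^ 2 / (1 + μ) / 2 * (1 + Real.cos ((1 - μ) / (1 + μ) * Real.pi)) * α ≤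
      closingRate (Real.cos α) ν τ := by
  have hpi := Real.pi_pos
  have hτm := one_add_mul_le_pi hν hνμ hμ (h1.trans hα)
  have hu0 : 0 < (1 - ν) * τ := mul_pos (by linarith) hτ
  have hα0 : 0 < α := by linarith
  have hkpi : (1 - μ) / (1 + μ) * Real.pi ≤ Real.pi := by
    refine mul_le_of_le_one_left hpi.le ?_
    rw [div_le_one (by linarith)]; linarith
  have hCk : Real.cos ((1 - μ) / (1 + μ) * Real.pi) ≤ Real.cos α :=
    Real.cos_le_cos_of_nonneg_of_le_pi hα0.le hkpi hα
  have hk0 : 0 ≤ 1 + Real.cos ((1 - μ) / (1 + μ) * Real.pi) := by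
    linarith [Real.neg_one_le_cos ((1 - μ) / (1 + μ) * Real.pi)]
  have hτpi : τ < Real.pi := by nlinarith
  have key := closingRate_lower_bound hν (by linarith) hτ hτpi
    (by nlinarith) (Real.cos_le_cos_of_nonneg_of_le_pi hu0.le (by linarith) h1)
  refine le_trans ?_ key
  have ht : (1 - ν) * τ / 2 ≤ Real.tan ((1 - ν) * τ / 2) :=
    Real.le_tan (by linarith) (by nlinarith)
  have hτα : α / (1 + μ) ≤ τ := by
    rw [div_le_iff₀ (by linarith)]; nlinarith
  have h3 : (1 - μ) * ((1 - μ) * (α / (1 + μ)) / 2) ≤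
      (1 - ν) * Real.tan ((1 - ν) * τ / 2) := by
    have a1 : 0 ≤ α / (1 + μ) := by positivity
    refine mul_le_mul (by linarith) (le_trans ?_ ht) ?_ (by linarith)
    · have := mul_le_mul (show 1 - μ ≤ 1 - ν by linarith) hτα a1 (by linarith)
      linarith
    · have := mul_nonneg (show 0 ≤ 1 - μ by linarith) a1
      linarith
  have h4 : 0 ≤ (1 - μ) * ((1 - μ) * (α / (1 + μ)) / 2) := by
    have := mul_nonneg (show 0 ≤ 1 - μ by linarith) (show 0 ≤ α / (1 + μ) by positivity)
    exact mul_nonneg (by linarith) (by linarith)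
  have h5 := mul_le_mul h3 (show 1 + Real.cos ((1 - μ) / (1 + μ) * Real.pi) ≤ 1 + Real.cos α by
    linarith) hk0 (h4.trans h3)
  refine le_trans (le_of_eq ?_) h5
  ring

theorem angular_bound_pos {μ : ℝ} (hμ0 : 0 < μ) (hμ : μ < 1) :
    0 < (1 - μ) / (1 + μ) * Real.pi :=
  mul_pos (div_pos (by linarith) (by linarith)) Real.pi_pos

theorem angular_bound_lt {μ : ℝ} (hμ0 : 0 < μ) (hμ : μ < 1) :
    (1 - μ) / (1 + μ) * Real.pi < (1 - μ) * Real.pi := by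
  refine mul_lt_mul_of_pos_right ?_ Real.pi_pos
  rw [div_lt_iff₀ (by linarith)]
  nlinarith

theorem one_add_cos_angular_bound_pos {μ : ℝ} (hμ0 : 0 < μ) (hμ : μ < 1) :
    0 < 1 + Real.cos ((1 - μ) / (1 + μ) * Real.pi) := by
  have h := Real.cos_lt_cos_of_nonneg_of_le_pi (angular_bound_pos hμ0 hμ).le le_rfl
    (show (1 - μ) / (1 + μ) * Real.pi < Real.pi by
      have := angular_bound_lt hμ0 hμ
      nlinarith [Real.pi_pos])
  rw [Real.cos_pi] at h
  linarith

/-- The players still do not separate if the angular condition is slightly violated. -/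
theorem exists_closingRate_nonneg_beyond {μ : ℝ} (hμ0 : 0 < μ) (hμ : μ < 1) :
    ∃ α₁, (1 - μ) / (1 + μ) * Real.pi < α₁ ∧ α₁ < (1 - μ) * Real.pi ∧
      ∀ α ν τ, (1 - μ) / (1 + μ) * Real.pi ≤ α → α ≤ α₁ → 0 ≤ ν → ν ≤ μ →
        (1 - ν) * τ ≤ α → α ≤ (1 + ν) * τ → 0 ≤ closingRate (Real.cos α) ν τ := by
  have hpi := Real.pi_pos
  set α₀ := (1 - μ) / (1 + μ) * Real.pi with hα₀
  have hα₀pos : 0 < α₀ := angular_bound_pos hμ0 hμ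
  have hα₀lt : α₀ < (1 - μ) * Real.pi := angular_bound_lt hμ0 hμ
  -- Distances below `(1 - μ) * π` force `τ < π`, so no denominator of the rate vanishes on the
  -- compact set `K`.
  obtain ⟨α₂, h02, h2⟩ := exists_between hα₀lt
  set K : Set (ℝ × ℝ × ℝ) := {q | α₀ ≤ q.1 ∧ q.1 ≤ α₂ ∧ 0 ≤ q.2.1 ∧ q.2.1 ≤ μ ∧
    (1 - q.2.1) * q.2.2 ≤ q.1 ∧ q.1 ≤ (1 + q.2.1) * q.2.2} with hK
  have hKτ : ∀ q ∈ K, 0 < q.2.2 ∧ q.2.2 < Real.pi := by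
    rintro ⟨α, ν, τ⟩ ⟨k1, k2, k3, k4, k5, k6⟩
    simp only at *
    have hτ0 : 0 < τ := by
      by_contra hτ0
      nlinarith
    refine ⟨hτ0, ?_⟩
    by_contra hτpi
    nlinarith
  have hKclosed : IsClosed K := by
    simp only [hK, ofPred_and]
    exact (isClosed_le (by fun_prop) (by fun_prop)).inter <|
      (isClosed_le (by fun_prop) (by fun_prop)).inter <|
      (isClosed_le (by fun_prop) (by fun_prop)).inter <|
      (isClosed_le (by fun_prop) (by fun_prop)).inter <|
      (isClosed_le (by fun_prop) (by fun_prop)).inter <|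
      isClosed_le (by fun_prop) (by fun_prop)
  have hKcompact : IsCompact K := by
    refine (isCompact_Icc.prod (isCompact_Icc.prod isCompact_Icc) :
      IsCompact (Icc α₀ α₂ ×ˢ Icc 0 μ ×ˢ Icc 0 Real.pi)).of_isClosed_subset hKclosed ?_
    rintro q hq
    have hτ := hKτ q hq
    obtain ⟨k1, k2, k3, k4, k5, k6⟩ := hq
    exact ⟨⟨k1, k2⟩, ⟨k3, k4⟩, ⟨hτ.1.le, hτ.2.le⟩⟩
  have hcont : ContinuousOn (fun q : ℝ × ℝ × ℝ => closingRate (Real.cos q.1) q.2.1 q.2.2) K := by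
    unfold closingRate
    have hsinc := Real.continuous_sinc
    refine ContinuousOn.add (ContinuousOn.div ?_ ?_ ?_) (ContinuousOn.div ?_ ?_ ?_)
    · fun_prop
    · fun_prop
    · intro q hq
      exact (Real.sin_pos_of_pos_of_lt_pi (hKτ q hq).1 (hKτ q hq).2).ne'
    · fun_prop
    · fun_prop
    · intro q hq
      obtain ⟨hτ1, hτ2⟩ := hKτ q hq
      obtain ⟨k1, k2, k3, k4, k5, k6⟩ := hq
      exact (mul_pos hτ1 (sinc_pos (by positivity) (by nlinarith))).ne'
  -- The bad states form a compact set. Its smallest `α` lies strictly above `α₀`, since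
  -- `closingRate_ge` makes the rate positive at `α₀` itself; any `α₁` in between works.
  set B := K ∩ (fun q : ℝ × ℝ × ℝ => closingRate (Real.cos q.1) q.2.1 q.2.2) ⁻¹' Iic 0 with hB
  have hBcompact : IsCompact B :=
    hKcompact.of_isClosed_subset (hcont.preimage_isClosed_of_isClosed hKclosed isClosed_Iic)
      inter_subset_left
  rcases B.eq_empty_or_nonempty with hBe | hBne
  · refine ⟨α₂, h02, h2, fun α ν τ a1 a2 a3 a4 a5 a6 => ?_⟩
    by_contra hneg
    have : (α, ν, τ) ∈ B := ⟨⟨a1, a2, a3, a4, a5, a6⟩, (not_le.1 hneg).le⟩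
    rw [hBe] at this
    exact this
  · obtain ⟨q, hqB, hqmin⟩ := hBcompact.exists_isMinOn hBne continuousOn_fst
    have hq : α₀ < q.1 := by
      refine lt_of_le_of_ne hqB.1.1 fun heq => ?_
      have hτ := hKτ q hqB.1
      obtain ⟨⟨k1, k2, k3, k4, k5, k6⟩, k7⟩ := hqB
      have := closingRate_ge hμ0 k3 k4 hμ hτ.1 k5 k6 heq.symm.le
      have hpos : 0 < (1 - μ) ^ 2 / (1 + μ) / 2 *
          (1 + Real.cos ((1 - μ) / (1 + μ) * Real.pi)) * q.1 := by
        have := one_add_cos_angular_bound_pos hμ0 hμ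
        have h1 : 0 < 1 - μ := by linarith
        have h3 : 0 < q.1 := by linarith
        positivity
      have h8 : closingRate (Real.cos q.1) q.2.1 q.2.2 ≤ 0 := k7
      linarith
    obtain ⟨α₁, h1, h1'⟩ := exists_between hq
    refine ⟨α₁, h1, by linarith [hqB.1.2.1], fun α ν τ a1 a2 a3 a4 a5 a6 => ?_⟩
    by_contra hneg
    have hmem : (α, ν, τ) ∈ B :=
      ⟨⟨a1, by linarith [hqB.1.2.1], a3, a4, a5, a6⟩, (not_le.1 hneg).le⟩
    have : q.1 ≤ α := hqmin hmem
    linarith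

/-! ### Geometry of a single position -/

/-- The pursuer at the unit vector `p` with unit velocity `v` and the evader at the unit vector `e`
with velocity `w` meet after time `τ`. -/
structure UnitIntercept (p e w v : E3) (τ : ℝ) : Prop where
  norm_p : ‖p‖ = 1
  norm_e : ‖e‖ = 1
  norm_v : ‖v‖ = 1
  inner_vp : inner ℝ v p = 0
  inner_we : inner ℝ w e = 0
  nonneg : 0 ≤ τ
  le_pi : τ ≤ Real.pi
  mul_le_pi : ‖w‖ * τ ≤ Real.pi
  eq : Real.cos (‖w‖ * τ) • e + (τ * Real.sinc (‖w‖ * τ)) • w = Real.cos τ • p + Real.sin τ • v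

theorem inner_eq_cos_angle {x y : E3} (hx : ‖x‖ = 1) (hy : ‖y‖ = 1) :
    inner ℝ x y = Real.cos (angle x y) := by
  rw [cos_angle, hx, hy]; simp

theorem angle_eq_of_inner_eq_cos {x y : E3} {θ : ℝ} (hx : ‖x‖ = 1) (hy : ‖y‖ = 1) (h0 : 0 ≤ θ)
    (hpi : θ ≤ Real.pi) (h : inner ℝ x y = Real.cos θ) : angle x y = θ := by
  rw [angle, hx, hy, h]
  simp [Real.arccos_cos h0 hpi]

/-- The great circle through the unit vector `e` with velocity `w`. -/
def geodesicArc (e w : E3) (τ : ℝ) : E3 :=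
  Real.cos (‖w‖ * τ) • e + (τ * Real.sinc (‖w‖ * τ)) • w

theorem norm_mul_sinc_eq (w : E3) (τ : ℝ) :
    ‖w‖ * (τ * Real.sinc (‖w‖ * τ)) = Real.sin (‖w‖ * τ) := by
  rw [← mul_assoc, mul_sinc]

theorem inner_geodesicArc {e w : E3} (he : ‖e‖ = 1) (hwe : inner ℝ w e = 0) (σ τ : ℝ) :
    inner ℝ (geodesicArc e w σ) (geodesicArc e w τ) = Real.cos (‖w‖ * σ - ‖w‖ * τ) := by
  have hew : inner ℝ e w = 0 := by rw [real_inner_comm]; exact hwe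
  simp only [geodesicArc, inner_add_left, inner_add_right, real_inner_smul_left,
    real_inner_smul_right, hwe, hew, real_inner_self_eq_norm_sq, he]
  rw [Real.cos_sub, ← norm_mul_sinc_eq, ← norm_mul_sinc_eq]
  ring

theorem norm_geodesicArc {e w : E3} (he : ‖e‖ = 1) (hwe : inner ℝ w e = 0) (τ : ℝ) :
    ‖geodesicArc e w τ‖ = 1 := by
  have h := inner_geodesicArc he hwe τ τ
  rw [real_inner_self_eq_norm_sq, sub_self, Real.cos_zero] at h
  nlinarith [norm_nonneg (geodesicArc e w τ)]

theorem inner_geodesicArc_base {e w : E3} (he : ‖e‖ = 1) (hwe : inner ℝ w e = 0) (τ : ℝ) :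
    inner ℝ (geodesicArc e w τ) e = Real.cos (‖w‖ * τ) := by
  simp only [geodesicArc, inner_add_left, real_inner_smul_left, hwe, real_inner_self_eq_norm_sq,
    he]
  ring

theorem angle_geodesicArc_le {e w : E3} (he : ‖e‖ = 1) (hwe : inner ℝ w e = 0) (σ τ : ℝ) :
    angle (geodesicArc e w σ) (geodesicArc e w τ) ≤ ‖w‖ * |σ - τ| := by
  have h0 : ‖w‖ * |σ - τ| = |‖w‖ * σ - ‖w‖ * τ| := by
    rw [← mul_sub, abs_mul, abs_of_nonneg (norm_nonneg w)]
  rcases le_or_gt (‖w‖ * |σ - τ|) Real.pi with h | h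
  · refine (angle_eq_of_inner_eq_cos (norm_geodesicArc he hwe σ) (norm_geodesicArc he hwe τ)
      (by positivity) h ?_).le
    rw [inner_geodesicArc he hwe, h0, Real.cos_abs]
  · exact (angle_le_pi _ _).trans h.le

namespace UnitIntercept

variable {p e w v x : E3} {τ : ℝ}

theorem geodesicArc_eq (h : UnitIntercept p e w v τ) :
    geodesicArc e w τ = Real.cos τ • p + Real.sin τ • v := h.eq

theorem inner_geodesicArc_pursuer (h : UnitIntercept p e w v τ) :
    inner ℝ (geodesicArc e w τ) p = Real.cos τ := by
  rw [h.geodesicArc_eq]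
  simp only [inner_add_left, real_inner_smul_left, h.inner_vp, real_inner_self_eq_norm_sq,
    h.norm_p]
  ring

theorem angle_evader (h : UnitIntercept p e w v τ) :
    angle (geodesicArc e w τ) e = ‖w‖ * τ :=
  angle_eq_of_inner_eq_cos (norm_geodesicArc h.norm_e h.inner_we τ) h.norm_e
    (mul_nonneg (norm_nonneg _) h.nonneg) h.mul_le_pi
    (inner_geodesicArc_base h.norm_e h.inner_we τ)

theorem angle_pursuer (h : UnitIntercept p e w v τ) :
    angle (geodesicArc e w τ) p = τ :=
  angle_eq_of_inner_eq_cos (norm_geodesicArc h.norm_e h.inner_we τ) h.norm_p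
    h.nonneg h.le_pi h.inner_geodesicArc_pursuer

theorem mul_le_angle (h : UnitIntercept p e w v τ) : (1 - ‖w‖) * τ ≤ angle p e := by
  have := angle_le_angle_add_angle (geodesicArc e w τ) e p
  rw [h.angle_evader, h.angle_pursuer, angle_comm] at this
  linarith

theorem angle_le_mul (h : UnitIntercept p e w v τ) : angle p e ≤ (1 + ‖w‖) * τ := by
  have := angle_le_angle_add_angle p (geodesicArc e w τ) e
  rw [h.angle_evader, angle_comm p (geodesicArc e w τ), h.angle_pursuer] at this
  linarith

theorem pos (h : UnitIntercept p e w v τ) (hpe : p ≠ e) : 0 < τ := by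
  refine h.nonneg.lt_of_ne fun h0 => hpe ?_
  have h1 := h.angle_le_mul
  rw [← h0, mul_zero] at h1
  exact eq_of_angle_eq_zero_of_norm_eq (le_antisymm h1 (angle_nonneg _ _))
    (h.norm_p.trans h.norm_e.symm)

theorem sin_mul_inner (h : UnitIntercept p e w v τ) (x : E3) :
    Real.sin τ * inner ℝ v x = inner ℝ (geodesicArc e w τ) x - Real.cos τ * inner ℝ p x := by
  rw [h.geodesicArc_eq, inner_add_left, real_inner_smul_left, real_inner_smul_left]
  ring

theorem sinc_mul_inner (x : E3) :
    (τ * Real.sinc (‖w‖ * τ)) * inner ℝ w x =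
      inner ℝ (geodesicArc e w τ) x - Real.cos (‖w‖ * τ) * inner ℝ e x := by
  rw [geodesicArc, inner_add_left, real_inner_smul_left, real_inner_smul_left]
  ring

theorem inner_add_inner_eq_closingRate (h : UnitIntercept p e w v τ) (hτ : 0 < τ)
    (hτpi : τ < Real.pi) (hw : ‖w‖ < 1) :
    inner ℝ v e + inner ℝ w p = closingRate (Real.cos (angle p e)) ‖w‖ τ := by
  have hs : Real.sin τ ≠ 0 := (Real.sin_pos_of_pos_of_lt_pi hτ hτpi).ne'
  have hS : τ * Real.sinc (‖w‖ * τ) ≠ 0 :=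
    (mul_pos hτ (sinc_pos (by positivity) (by nlinarith [norm_nonneg w]))).ne'
  have h1 := h.sin_mul_inner e
  have h2 := sinc_mul_inner (e := e) (w := w) (τ := τ) p
  rw [inner_geodesicArc_base h.norm_e h.inner_we, inner_eq_cos_angle h.norm_p h.norm_e] at h1
  rw [h.inner_geodesicArc_pursuer, inner_eq_cos_angle h.norm_e h.norm_p, angle_comm e p] at h2
  unfold closingRate
  congr 1
  · rw [eq_div_iff hs]; linarith
  · rw [eq_div_iff hS]; linarith

/-- The angle from `x` to a moving unit vector changes at minus the inner product of `x` with the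
velocity, divided by the sine of the angle. The inequality thus says that the ratio of angles,
currently `m`, has nonnegative derivative. Both inner products are computed from the intercept
point, which reduces the claim to `ratio_inequality`. -/
theorem ratio_rate (h : UnitIntercept p e w v τ) (hpe : p ≠ e) {m : ℝ} (hm0 : 0 < m) (hm : m < 1)
    (hwm : ‖w‖ ≤ m) (hα : angle p e ≤ (1 - m) / (1 + m) * Real.pi) (hx : ‖x‖ = 1)
    (hab : angle x e = m * angle x p) :
    inner ℝ w x / Real.sin (angle x e) ≤ m * (inner ℝ v x / Real.sin (angle x p)) := by
  have hτ := h.pos hpe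
  have ha : 0 < angle x p := by
    refine (angle_nonneg _ _).lt_of_ne fun h0 => hpe ?_
    rw [← h0, mul_zero] at hab
    rw [← eq_of_angle_eq_zero_of_norm_eq h0.symm (hx.trans h.norm_p.symm)]
    exact eq_of_angle_eq_zero_of_norm_eq hab (hx.trans h.norm_e.symm)
  have h1 := h.mul_le_angle
  -- The triangle inequality gives `(1 - m) * angle x p ≤ angle p e`, so `angle x p` obeys the same
  -- bound as an interception time at evader speed `m`.
  have ham : (1 + m) * angle x p ≤ Real.pi := by
    refine one_add_mul_le_pi hm0.le le_rfl hm (le_trans ?_ hα)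
    have := angle_le_angle_add_angle x e p
    rw [angle_comm e p] at this
    linarith
  have hτm := one_add_mul_le_pi (norm_nonneg w) hwm hm (h1.trans hα)
  have hs : Real.sin τ ≠ 0 := (Real.sin_pos_of_pos_of_lt_pi hτ (by nlinarith)).ne'
  have hS : τ * Real.sinc (‖w‖ * τ) ≠ 0 :=
    (mul_pos hτ (sinc_pos (by positivity) (by nlinarith [norm_nonneg w]))).ne'
  have hc : Real.cos (angle (geodesicArc e w τ) x) ≤
      Real.cos (m * angle x p - ‖w‖ * τ) := by
    rw [← hab, ← Real.cos_abs (angle x e - _)]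
    refine Real.cos_le_cos_of_nonneg_of_le_pi (abs_nonneg _) (angle_le_pi _ _) ?_
    rw [abs_le]
    have t1 := angle_le_angle_add_angle x (geodesicArc e w τ) e
    have t2 := angle_le_angle_add_angle (geodesicArc e w τ) x e
    rw [h.angle_evader] at t1 t2
    rw [angle_comm x (geodesicArc e w τ)] at t1
    constructor <;> linarith
  have key := ratio_inequality (norm_nonneg w) hwm hm0 hm ha hτ ham (h1.trans hα) hc
  have h3 := h.sin_mul_inner x
  have h4 := sinc_mul_inner (e := e) (w := w) (τ := τ) x
  rw [inner_eq_cos_angle (norm_geodesicArc h.norm_e h.inner_we τ) hx,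
    inner_eq_cos_angle h.norm_p hx, angle_comm p] at h3
  rw [inner_eq_cos_angle (norm_geodesicArc h.norm_e h.inner_we τ) hx,
    inner_eq_cos_angle h.norm_e hx, angle_comm e, hab] at h4
  rw [← h3, ← h4, mul_div_cancel_left₀ _ hs, mul_div_cancel_left₀ _ hS, ← hab] at key
  exact key

end UnitIntercept

/-! ### Scaling to the unit sphere and unit pursuer speed -/

theorem geodesicPoint_eq {R vP : ℝ} (hR : 0 < R) (hv : 0 < vP) (x w : E3) (τ : ℝ) :
    geodesicPoint R x w τ =
      R • geodesicArc (R⁻¹ • x) (vP⁻¹ • w) (vP * τ / R) := by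
  have hn : ‖vP⁻¹ • w‖ * (vP * τ / R) = ‖w‖ * τ / R := by
    rw [norm_smul, Real.norm_of_nonneg (inv_nonneg.2 hv.le)]
    field_simp
  rw [geodesicPoint, geodesicArc, hn, smul_add, smul_smul, smul_smul, smul_smul, smul_smul]
  congr 1
  · congr 1; field_simp
  · rcases eq_or_ne w 0 with rfl | hw
    · simp
    · congr 1
      have hw' : ‖w‖ ≠ 0 := norm_ne_zero_iff.2 hw
      rw [div_eq_iff hw']
      rw [← mul_sinc]
      field_simp

theorem angle_inv_smul {R : ℝ} (hR : 0 < R) (x y : E3) :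
    angle (R⁻¹ • x) (R⁻¹ • y) = angle x y :=
  angle_smul_smul (inv_ne_zero hR.ne') x y

theorem norm_inv_smul_eq_one {R : ℝ} (hR : 0 < R) {x : E3} (hx : ‖x‖ = R) : ‖R⁻¹ • x‖ = 1 := by
  rw [norm_smul, hx, Real.norm_of_nonneg (inv_nonneg.2 hR.le), inv_mul_cancel₀ hR.ne']

theorem geodesicArc_of_norm_one {p v : E3} (hv : ‖v‖ = 1) (τ : ℝ) :
    geodesicArc p v τ = Real.cos τ • p + Real.sin τ • v := by
  rw [geodesicArc, hv, one_mul, mul_sinc]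

theorem IsGeodesicParallelVelocity.unitIntercept {R vP : ℝ} (hR : 0 < R) (hvP : 0 < vP)
    {P E w v : E3} (hP : ‖P‖ = R) (hE : ‖E‖ = R) (hwE : inner ℝ w E = 0)
    (h : IsGeodesicParallelVelocity R vP P E w v) :
    ∃ τ, UnitIntercept (R⁻¹ • P) (R⁻¹ • E) (vP⁻¹ • w) (vP⁻¹ • v) τ := by
  obtain ⟨hv, hvp, I, τ, ⟨hτ, hI, hIE, hIP⟩, hPI⟩ := h
  have hv1 := norm_inv_smul_eq_one hvP hv
  refine ⟨vP * τ / R, norm_inv_smul_eq_one hR hP, norm_inv_smul_eq_one hR hE, hv1, ?_, ?_,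
    by positivity, ?_, ?_, ?_⟩
  · rw [real_inner_smul_left, real_inner_smul_right, hvp]; simp
  · rw [real_inner_smul_left, real_inner_smul_right, hwE]; simp
  · rw [div_le_iff₀ hR, ← hIP, arcLen, mul_comm]
    exact mul_le_mul_of_nonneg_right (angle_le_pi _ _) hR.le
  · have : ‖vP⁻¹ • w‖ * (vP * τ / R) = ‖w‖ * τ / R := by
      rw [norm_smul, Real.norm_of_nonneg (inv_nonneg.2 hvP.le)]
      field_simp
    rw [this, div_le_iff₀ hR, ← hIE, arcLen, mul_comm]
    exact mul_le_mul_of_nonneg_right (angle_le_pi _ _) hR.le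
  · rw [geodesicPoint_eq hR hvP] at hI hPI
    have := smul_right_injective E3 hR.ne' (hI.symm.trans hPI.symm)
    rw [geodesicArc_of_norm_one hv1] at this
    exact this

theorem UnitIntercept.isGeodesicParallelVelocity {R vP : ℝ} (hR : 0 < R) (hvP : 0 < vP)
    {P E w v : E3} {τ : ℝ}
    (h : UnitIntercept (R⁻¹ • P) (R⁻¹ • E) (vP⁻¹ • w) v τ) :
    IsGeodesicParallelVelocity R vP P E w (vP • v) := by
  have e1 : vP * (R * τ / vP) / R = τ := by field_simp
  have e2 : vP⁻¹ • vP • v = v := by rw [smul_smul, inv_mul_cancel₀ hvP.ne', one_smul]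
  have hτ := h.nonneg
  refine ⟨?_, ?_, R • geodesicArc (R⁻¹ • E) (vP⁻¹ • w) τ, R * τ / vP, ⟨by positivity, ?_, ?_, ?_⟩,
    ?_⟩
  · rw [norm_smul, h.norm_v, Real.norm_of_nonneg hvP.le, mul_one]
  · have := h.inner_vp
    rw [real_inner_smul_right] at this
    rw [real_inner_smul_left, (mul_eq_zero.1 this).resolve_left (inv_ne_zero hR.ne'), mul_zero]
  · rw [geodesicPoint_eq hR hvP, e1]
  · have := h.angle_evader
    rw [angle_smul_right_of_pos _ _ (inv_pos.2 hR)] at this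
    rw [arcLen, angDist, angle_smul_left_of_pos _ _ hR, this, norm_smul,
      Real.norm_of_nonneg (inv_nonneg.2 hvP.le)]
    field_simp
  · have := h.angle_pursuer
    rw [angle_smul_right_of_pos _ _ (inv_pos.2 hR)] at this
    rw [arcLen, angDist, angle_smul_left_of_pos _ _ hR, this]
    field_simp
  · rw [geodesicPoint_eq hR hvP, e1, e2, geodesicArc_of_norm_one h.norm_v, h.geodesicArc_eq]

/-! ### Monotonicity along absolutely continuous motions -/

/-- An absolutely continuous function is recovered by integrating its derivative, so null sets of
times can be ignored. -/
theorem AbsolutelyContinuousOnInterval.le_of_ae_deriv_nonneg {f : ℝ → ℝ} {a b : ℝ} (hab : a ≤ b)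
    (hf : AbsolutelyContinuousOnInterval f a b)
    (h : ∀ᵐ t : ℝ, t ∈ Ioo a b → ∃ f', HasDerivAt f f' t ∧ 0 ≤ f') : f a ≤ f b := by
  rw [← sub_nonneg, ← hf.integral_deriv_eq_sub]
  refine intervalIntegral.integral_nonneg_of_ae_restrict hab ?_
  rw [EventuallyLE, ae_restrict_iff' measurableSet_Icc]
  have hne : ∀ c : ℝ, ∀ᵐ t : ℝ, t ≠ c := fun c => by
    simp [ae_iff, measure_singleton]
  filter_upwards [h, hne a, hne b] with t ht ha hb htm
  obtain ⟨f', hf', h0⟩ := ht ⟨lt_of_le_of_ne htm.1 ha.symm, lt_of_le_of_ne htm.2 hb⟩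
  rw [hf'.deriv]
  exact h0

/-- The chord is `2 * sin (angle x y / 2)`, and Jordan's inequality bounds the sine from below. This
makes angles along Lipschitz motions Lipschitz. -/
theorem angle_le_mul_norm_sub {x y : E3} (hx : ‖x‖ = 1) (hy : ‖y‖ = 1) :
    angle x y ≤ Real.pi / 2 * ‖x - y‖ := by
  have h0 := angle_nonneg x y
  have hpi := angle_le_pi x y
  have h1 : ‖x - y‖ ^ 2 = (2 * Real.sin (angle x y / 2)) ^ 2 := by
    rw [norm_sub_sq_real, hx, hy, inner_eq_cos_angle hx hy, mul_pow, Real.sin_sq_eq_half_sub,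
      mul_div_cancel₀ _ two_ne_zero]
    ring
  have h2 : 0 ≤ Real.sin (angle x y / 2) :=
    Real.sin_nonneg_of_nonneg_of_le_pi (by linarith) (by linarith)
  have h3 : ‖x - y‖ = 2 * Real.sin (angle x y / 2) :=
    (sq_eq_sq₀ (norm_nonneg _) (by linarith)).1 h1
  have h4 := Real.mul_le_sin (x := angle x y / 2) (by linarith) (by linarith)
  rw [h3]
  have h5 := mul_le_mul_of_nonneg_left h4 (show 0 ≤ Real.pi by positivity)
  have h6 : Real.pi * (2 / Real.pi * (angle x y / 2)) = angle x y := by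
    field_simp
  linarith

theorem abs_angle_sub_angle_le {x y x' y' : E3} (hx : ‖x‖ = 1) (hy : ‖y‖ = 1) (hx' : ‖x'‖ = 1)
    (hy' : ‖y'‖ = 1) :
    |angle x y - angle x' y'| ≤ Real.pi / 2 * (‖x - x'‖ + ‖y - y'‖) := by
  have a1 := angle_le_mul_norm_sub hx hx'
  have a2 := angle_le_mul_norm_sub hy hy'
  have b1 := angle_le_angle_add_angle x x' y
  have b2 := angle_le_angle_add_angle x' y' y
  have b3 := angle_le_angle_add_angle x' x y'
  have b4 := angle_le_angle_add_angle x y y'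
  rw [angle_comm x' x] at b3
  rw [angle_comm y' y] at b2
  rw [abs_le]
  constructor <;> linarith

theorem hasDerivAt_angle {x y : ℝ → E3} {x' y' : E3} {t : ℝ} (hx : HasDerivAt x x' t)
    (hy : HasDerivAt y y' t) (hx1 : ∀ᶠ s in 𝓝 t, ‖x s‖ = 1) (hy1 : ∀ᶠ s in 𝓝 t, ‖y s‖ = 1)
    (h0 : 0 < angle (x t) (y t)) (hpi : angle (x t) (y t) < Real.pi) :
    HasDerivAt (fun s => angle (x s) (y s))
      (-((inner ℝ (x t) y' + inner ℝ x' (y t)) / Real.sin (angle (x t) (y t)))) t := by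
  have hc := inner_eq_cos_angle hx1.self_of_nhds hy1.self_of_nhds
  have hs : 0 < Real.sin (angle (x t) (y t)) := Real.sin_pos_of_pos_of_lt_pi h0 hpi
  have h1 : inner ℝ (x t) (y t) ≠ -1 := by
    intro h; rw [hc] at h; nlinarith [Real.sin_sq_add_cos_sq (angle (x t) (y t))]
  have h2 : inner ℝ (x t) (y t) ≠ 1 := by
    intro h; rw [hc] at h; nlinarith [Real.sin_sq_add_cos_sq (angle (x t) (y t))]
  have hd := (Real.hasDerivAt_arccos h1 h2).comp t (hx.inner ℝ hy)
  have hsq : √(1 - inner ℝ (x t) (y t) ^ 2) = Real.sin (angle (x t) (y t)) := by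
    rw [hc, ← Real.abs_sin_eq_sqrt_one_sub_cos_sq, abs_of_pos hs]
  rw [hsq] at hd
  refine (hd.congr_of_eventuallyEq ?_).congr_deriv ?_
  · filter_upwards [hx1, hy1] with s hsx hsy
    simp [angle, hsx, hsy]
  · rw [neg_mul, one_div, inv_mul_eq_div]

/-- Two motions on the unit sphere, of which the pursuer `p` follows the geodesic parallel strategy
with speed `κ` up to time `T`, the evader has speed at most `μ * κ`, and there is no capture before
time `T`. -/
structure UnitPursuit (κ μ T : ℝ) (p e : ℝ → E3) : Prop where
  norm_p : ∀ t ∈ Icc 0 T, ‖p t‖ = 1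
  norm_e : ∀ t ∈ Icc 0 T, ‖e t‖ = 1
  lip_p : ∀ s ∈ Icc 0 T, ∀ t ∈ Icc 0 T, ‖p s - p t‖ ≤ κ * |s - t|
  lip_e : ∀ s ∈ Icc 0 T, ∀ t ∈ Icc 0 T, ‖e s - e t‖ ≤ κ * |s - t|
  ne : ∀ t ∈ Ico 0 T, p t ≠ e t
  strategy : ∀ᵐ t : ℝ, t ∈ Ioo 0 T → ∃ w v τ, HasDerivAt p (κ • v) t ∧ HasDerivAt e (κ • w) t ∧
    ‖w‖ ≤ μ ∧ UnitIntercept (p t) (e t) w v τ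

theorem lipschitzOnWith_angle {κ T : ℝ} (hκ : 0 ≤ κ) {p e : ℝ → E3}
    (norm_p : ∀ t ∈ Icc 0 T, ‖p t‖ = 1) (norm_e : ∀ t ∈ Icc 0 T, ‖e t‖ = 1)
    (lip_p : ∀ s ∈ Icc 0 T, ∀ t ∈ Icc 0 T, ‖p s - p t‖ ≤ κ * |s - t|)
    (lip_e : ∀ s ∈ Icc 0 T, ∀ t ∈ Icc 0 T, ‖e s - e t‖ ≤ κ * |s - t|) :
    LipschitzOnWith (Real.toNNReal (Real.pi * κ)) (fun t => angle (p t) (e t)) (Icc 0 T) := by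
  have hpi := Real.pi_pos
  refine LipschitzOnWith.of_dist_le_mul fun s hs t ht => ?_
  rw [Real.coe_toNNReal _ (by positivity), Real.dist_eq, Real.dist_eq]
  refine (abs_angle_sub_angle_le (norm_p s hs) (norm_e s hs) (norm_p t ht)
    (norm_e t ht)).trans ?_
  have := mul_le_mul_of_nonneg_left (add_le_add (lip_p s hs t ht) (lip_e s hs t ht))
    (show 0 ≤ Real.pi / 2 by positivity)
  linarith

/-- Lower bound for the speed at which the players approach each other. -/
def approachSpeed (μ : ℝ) : ℝ :=
  (1 - μ) ^ 2 / (1 + μ) / 2 * (1 + Real.cos ((1 - μ) / (1 + μ) * Real.pi))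

theorem approachSpeed_pos {μ : ℝ} (hμ0 : 0 < μ) (hμ : μ < 1) : 0 < approachSpeed μ := by
  have h1 := one_add_cos_angular_bound_pos hμ0 hμ
  have h2 : 0 < 1 - μ := by linarith
  unfold approachSpeed
  positivity

/-! ### Estimates along a pursuit -/

namespace UnitPursuit

variable {κ μ T : ℝ} {p e : ℝ → E3}

theorem lipschitzOnWith_distance (h : UnitPursuit κ μ T p e) (hκ : 0 ≤ κ) :
    LipschitzOnWith (Real.toNNReal (Real.pi * κ)) (fun t => angle (p t) (e t)) (Icc 0 T) :=
  lipschitzOnWith_angle hκ h.norm_p h.norm_e h.lip_p h.lip_e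

theorem lipschitzOnWith_angle_p (h : UnitPursuit κ μ T p e) (hκ : 0 ≤ κ) {x : E3}
    (hx : ‖x‖ = 1) :
    LipschitzOnWith (Real.toNNReal (Real.pi * κ)) (fun t => angle x (p t)) (Icc 0 T) :=
  lipschitzOnWith_angle (p := fun _ => x) hκ (fun _ _ => hx) h.norm_p
    (fun s _ t _ => by simp; positivity) h.lip_p

theorem lipschitzOnWith_angle_e (h : UnitPursuit κ μ T p e) (hκ : 0 ≤ κ) {x : E3}
    (hx : ‖x‖ = 1) :
    LipschitzOnWith (Real.toNNReal (Real.pi * κ)) (fun t => angle x (e t)) (Icc 0 T) :=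
  lipschitzOnWith_angle (p := fun _ => x) hκ (fun _ _ => hx) h.norm_e
    (fun s _ t _ => by simp; positivity) h.lip_e

theorem angle_pos (h : UnitPursuit κ μ T p e) {t : ℝ} (ht : t ∈ Ico 0 T) :
    0 < angle (p t) (e t) := by
  refine (angle_nonneg _ _).lt_of_ne fun h0 => h.ne t ht ?_
  exact eq_of_angle_eq_zero_of_norm_eq h0.symm
    ((h.norm_p t ⟨ht.1, ht.2.le⟩).trans (h.norm_e t ⟨ht.1, ht.2.le⟩).symm)

theorem eventually_norm_p (h : UnitPursuit κ μ T p e) {t : ℝ} (ht : t ∈ Ioo 0 T) :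
    ∀ᶠ s in 𝓝 t, ‖p s‖ = 1 := by
  filter_upwards [Ioo_mem_nhds ht.1 ht.2] with s hs
  exact h.norm_p s ⟨hs.1.le, hs.2.le⟩

theorem eventually_norm_e (h : UnitPursuit κ μ T p e) {t : ℝ} (ht : t ∈ Ioo 0 T) :
    ∀ᶠ s in 𝓝 t, ‖e s‖ = 1 := by
  filter_upwards [Ioo_mem_nhds ht.1 ht.2] with s hs
  exact h.norm_e s ⟨hs.1.le, hs.2.le⟩

theorem hasDerivAt_distance (h : UnitPursuit κ μ T p e) {t : ℝ} (ht : t ∈ Ioo 0 T)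
    (hμ : μ < 1) (hα : angle (p t) (e t) < (1 - μ) * Real.pi) (hμ0 : 0 < μ) {w v : E3} {τ : ℝ}
    (hp : HasDerivAt p (κ • v) t) (he : HasDerivAt e (κ • w) t) (hw : ‖w‖ ≤ μ)
    (hI : UnitIntercept (p t) (e t) w v τ) :
    HasDerivAt (fun s => angle (p s) (e s))
      (-(κ * closingRate (Real.cos (angle (p t) (e t))) ‖w‖ τ /
        Real.sin (angle (p t) (e t)))) t := by
  have hpi := Real.pi_pos
  have ht' : t ∈ Ico 0 T := ⟨ht.1.le, ht.2⟩
  have hτ := hI.pos (h.ne t ht')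
  have hτpi : τ < Real.pi := by
    have := hI.mul_le_angle
    by_contra hcon
    nlinarith
  refine (hasDerivAt_angle hp he (h.eventually_norm_p ht) (h.eventually_norm_e ht)
    (h.angle_pos ht') (by nlinarith)).congr_deriv ?_
  rw [← hI.inner_add_inner_eq_closingRate hτ hτpi (by linarith), real_inner_smul_left,
    real_inner_smul_right, real_inner_comm w (p t)]
  ring

/-- `closingRate_ge` presupposes the angular condition, and `exists_closingRate_nonneg_beyond`
breaks the circle: just after the last time `t₀` within the bound, the distance is still below `α₁`
and therefore cannot increase. -/
theorem angle_le (h : UnitPursuit κ μ T p e) (hκ : 0 < κ) (hμ0 : 0 < μ) (hμ : μ < 1)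
    (h0 : angle (p 0) (e 0) ≤ (1 - μ) / (1 + μ) * Real.pi) {t : ℝ} (ht : t ∈ Icc 0 T) :
    angle (p t) (e t) ≤ (1 - μ) / (1 + μ) * Real.pi := by
  by_contra hcon
  rw [not_le] at hcon
  obtain ⟨α₁, hα₁, hα₁', hrate⟩ := exists_closingRate_nonneg_beyond hμ0 hμ
  set c := (1 - μ) / (1 + μ) * Real.pi with hc
  have hlip := h.lipschitzOnWith_distance hκ.le
  have hcont := hlip.continuousOn
  set S := Icc 0 t ∩ (fun s => angle (p s) (e s)) ⁻¹' Iic c with hS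
  have hsub : Icc 0 t ⊆ Icc 0 T := Icc_subset_Icc_right ht.2
  have hSclosed : IsClosed S := (hcont.mono hsub).preimage_isClosed_of_isClosed isClosed_Icc isClosed_Iic
  have hScompact : IsCompact S := isCompact_Icc.of_isClosed_subset hSclosed inter_subset_left
  have hSne : S.Nonempty := ⟨0, ⟨le_rfl, ht.1⟩, h0⟩
  have ht0 := hScompact.sSup_mem hSne
  set t₀ := sSup S with ht₀
  have ht0t : t₀ < t := by
    refine lt_of_le_of_ne ht0.1.2 fun heq => ?_
    have : angle (p t₀) (e t₀) ≤ c := ht0.2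
    rw [heq] at this
    linarith
  have hgt : ∀ u ∈ Ioc t₀ t, c < angle (p u) (e u) := by
    intro u hu
    by_contra hle
    have : u ≤ t₀ := le_csSup hScompact.bddAbove
      ⟨⟨ht0.1.1.trans hu.1.le, hu.2⟩, not_lt.1 hle⟩
    linarith [hu.1]
  have hlt : ∀ᶠ u in 𝓝[Icc 0 T] t₀, angle (p u) (e u) < α₁ :=
    (hcont t₀ (hsub ht0.1)).eventually_lt_const (lt_of_le_of_lt ht0.2 hα₁)
  rw [eventually_nhdsWithin_iff, Metric.eventually_nhds_iff] at hlt
  obtain ⟨ε, hε, hlt⟩ := hlt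
  obtain ⟨t₂, h02, h2⟩ := exists_between (lt_min ht0t (show t₀ < t₀ + ε by linarith))
  have h2t := h2.trans_le (min_le_left _ _)
  have h2ε := h2.trans_le (min_le_right _ _)
  have hmono : -angle (p t₀) (e t₀) ≤ -angle (p t₂) (e t₂) := by
    refine AbsolutelyContinuousOnInterval.le_of_ae_deriv_nonneg
      (f := fun u => -angle (p u) (e u)) h02.le ?_ ?_
    · refine (LipschitzOnWith.absolutelyContinuousOnInterval (hlip.mono ?_)).neg
      rw [uIcc_of_le h02.le]
      exact Icc_subset_Icc ht0.1.1 (h2t.le.trans ht.2)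
    · filter_upwards [h.strategy] with u hu hu'
      have hu0 : u ∈ Ioo 0 T :=
        ⟨ht0.1.1.trans_lt hu'.1, (hu'.2.trans h2t).trans_le ht.2⟩
      obtain ⟨w, v, τ, hp, he, hw, hI⟩ := hu hu0
      have hu1 : angle (p u) (e u) < α₁ := by
        refine hlt ?_ ⟨hu0.1.le, hu0.2.le⟩
        rw [Real.dist_eq, abs_of_pos (by linarith [hu'.1])]
        linarith [hu'.2]
      have hα : angle (p u) (e u) < (1 - μ) * Real.pi := by linarith
      refine ⟨_, (h.hasDerivAt_distance hu0 hμ hα hμ0 hp he hw hI).neg, ?_⟩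
      rw [neg_neg]
      have := hrate (angle (p u) (e u)) ‖w‖ τ (hgt u ⟨hu'.1, (hu'.2.trans h2t).le⟩).le hu1.le
        (norm_nonneg w) hw hI.mul_le_angle hI.angle_le_mul
      exact div_nonneg (mul_nonneg hκ.le this) (sin_angle_nonneg _ _)
  have h3 : angle (p t₀) (e t₀) ≤ c := ht0.2
  have h4 := hgt t₂ ⟨h02, h2t.le⟩
  linarith

theorem angle_add_le (h : UnitPursuit κ μ T p e) (hκ : 0 < κ) (hμ0 : 0 < μ) (hμ : μ < 1)
    (h0 : angle (p 0) (e 0) ≤ (1 - μ) / (1 + μ) * Real.pi) {s t : ℝ} (hs : 0 ≤ s) (hst : s ≤ t)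
    (ht : t ≤ T) :
    angle (p t) (e t) + κ * approachSpeed μ * (t - s) ≤ angle (p s) (e s) := by
  have hlip := h.lipschitzOnWith_distance hκ.le
  have hsub : uIcc s t ⊆ Icc 0 T := by
    rw [uIcc_of_le hst]; exact Icc_subset_Icc hs ht
  have hmono : -angle (p s) (e s) - κ * approachSpeed μ * s ≤
      -angle (p t) (e t) - κ * approachSpeed μ * t := by
    refine AbsolutelyContinuousOnInterval.le_of_ae_deriv_nonneg
      (f := fun u => -angle (p u) (e u) - κ * approachSpeed μ * u) hst ?_ ?_
    · refine (LipschitzOnWith.absolutelyContinuousOnInterval (hlip.mono hsub)).neg.sub ?_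
      exact ((LipschitzWith.id (α := ℝ)).lipschitzOnWith (s := uIcc s t)
        |>.absolutelyContinuousOnInterval).const_mul _
    · filter_upwards [h.strategy] with u hu hu'
      have hu0 : u ∈ Ioo 0 T := ⟨hs.trans_lt hu'.1, hu'.2.trans_le ht⟩
      obtain ⟨w, v, τ, hp, he, hw, hI⟩ := hu hu0
      have hα0 := h.angle_le hκ hμ0 hμ h0 ⟨hu0.1.le, hu0.2.le⟩
      have hα : angle (p u) (e u) < (1 - μ) * Real.pi :=
        hα0.trans_lt (angular_bound_lt hμ0 hμ)
      have hpos := h.angle_pos ⟨hu0.1.le, hu0.2⟩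
      have hτ := hI.pos (h.ne u ⟨hu0.1.le, hu0.2⟩)
      have hsin : 0 < Real.sin (angle (p u) (e u)) :=
        Real.sin_pos_of_pos_of_lt_pi hpos (by nlinarith [Real.pi_pos])
      refine ⟨_, (h.hasDerivAt_distance hu0 hμ hα hμ0 hp he hw hI).neg.sub
        ((hasDerivAt_id u).const_mul _), ?_⟩
      -- The cosine of the distance grows at a rate at least proportional to the distance; division
      -- by its sine, which is no larger than the distance, leaves a constant rate.
      rw [neg_neg, mul_one, sub_nonneg, le_div_iff₀ hsin, mul_assoc]
      refine mul_le_mul_of_nonneg_left ?_ hκ.le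
      refine le_trans ?_ (closingRate_ge hμ0 (norm_nonneg w) hw hμ hτ hI.mul_le_angle
        hI.angle_le_mul hα0)
      exact mul_le_mul_of_nonneg_left (Real.sin_le hpos.le) (approachSpeed_pos hμ0 hμ).le
  linarith

/-- The ratio of the distances from a fixed point to evader and pursuer does not decrease. -/
theorem ratio_monotone (h : UnitPursuit κ μ T p e) (hκ : 0 < κ) (hμ0 : 0 < μ)
    {m' : ℝ} (hm' : m' < 1) {s t : ℝ} (hs : 0 ≤ s) (hst : s ≤ t) (ht : t < T)
    (hα : ∀ u ∈ Icc s t, angle (p u) (e u) ≤ (1 - m') / (1 + m') * Real.pi) {x : E3}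
    (hx : ‖x‖ = 1) (ha : ∀ u ∈ Icc s t, 0 < angle x (p u))
    (hr : ∀ u ∈ Ioo s t, μ ≤ angle x (e u) / angle x (p u) ∧
      angle x (e u) / angle x (p u) ≤ m') :
    angle x (e s) / angle x (p s) ≤ angle x (e t) / angle x (p t) := by
  have hpi := Real.pi_pos
  have hsub : Icc s t ⊆ Icc 0 T := Icc_subset_Icc hs ht.le
  have hlipa := (h.lipschitzOnWith_angle_p hκ.le hx).mono hsub
  have hlipb := (h.lipschitzOnWith_angle_e hκ.le hx).mono hsub
  -- The positive minimum of the distance to the pursuer makes its reciprocal Lipschitz, so that the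
  -- ratio is absolutely continuous.
  obtain ⟨u₀, hu₀, hmin⟩ := isCompact_Icc.exists_isMinOn ⟨s, le_rfl, hst⟩ hlipa.continuousOn
  set c := angle x (p u₀) with hc
  have hc0 : 0 < c := ha u₀ hu₀
  have hmin' : ∀ u ∈ Icc s t, c ≤ angle x (p u) := fun u hu => hmin hu
  have hinv : LipschitzOnWith (Real.toNNReal (Real.pi * κ / c ^ 2))
      (fun u => (angle x (p u))⁻¹) (Icc s t) := by
    refine LipschitzOnWith.of_dist_le_mul fun u hu u' hu' => ?_
    have h1 := hlipa.dist_le_mul u hu u' hu'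
    rw [Real.coe_toNNReal _ (by positivity)] at h1 ⊢
    rw [Real.dist_eq] at h1 ⊢
    have p1 := ha u hu
    have p2 := ha u' hu'
    rw [inv_sub_inv p1.ne' p2.ne', abs_div, abs_sub_comm, abs_of_pos (mul_pos p1 p2),
      div_le_iff₀ (mul_pos p1 p2)]
    have h2 : c ^ 2 ≤ angle x (p u) * angle x (p u') := by
      rw [sq]; exact mul_le_mul (hmin' u hu) (hmin' u' hu') hc0.le p1.le
    refine h1.trans ?_
    have h3 : 0 ≤ Real.pi * κ / c ^ 2 * dist u u' := by positivity
    have h4 : Real.pi * κ * dist u u' = Real.pi * κ / c ^ 2 * dist u u' * c ^ 2 := by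
      field_simp
    rw [h4]
    exact mul_le_mul_of_nonneg_left h2 h3
  refine AbsolutelyContinuousOnInterval.le_of_ae_deriv_nonneg
    (f := fun u => angle x (e u) / angle x (p u)) hst ?_ ?_
  · rw [← uIcc_of_le hst] at hlipb hinv
    exact hlipb.absolutelyContinuousOnInterval.mul hinv.absolutelyContinuousOnInterval
  · filter_upwards [h.strategy] with u hu hu'
    have hu0 : u ∈ Ioo 0 T := ⟨hs.trans_lt hu'.1, hu'.2.trans ht⟩
    have huI : u ∈ Icc s t := ⟨hu'.1.le, hu'.2.le⟩
    obtain ⟨w, v, τ, hp, he, hw, hI⟩ := hu hu0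
    have hau := ha u huI
    obtain ⟨hr1, hr2⟩ := hr u hu'
    -- `ratio_rate` is applied with the current ratio rather than with `μ`: `μ ≤ m` covers the
    -- evader's speed, and `m ≤ m'` makes the angular condition for `m` follow from the one for
    -- `m'`.
    set m := angle x (e u) / angle x (p u) with hm
    have hm0 : 0 < m := hμ0.trans_le hr1
    have hab : angle x (e u) = m * angle x (p u) := by rw [hm]; field_simp
    have hαm : angle (p u) (e u) ≤ (1 - m) / (1 + m) * Real.pi := by
      refine (hα u huI).trans (mul_le_mul_of_nonneg_right ?_ hpi.le)
      rw [div_le_div_iff₀ (by linarith) (by linarith)]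
      nlinarith
    have hb0 : 0 < angle x (e u) := by rw [hab]; positivity
    have ham : (1 + m) * angle x (p u) ≤ Real.pi := by
      refine one_add_mul_le_pi hm0.le le_rfl (hr2.trans_lt hm') (le_trans ?_ hαm)
      have := angle_le_angle_add_angle x (e u) (p u)
      rw [angle_comm (e u) (p u)] at this
      linarith
    have hapi : angle x (p u) < Real.pi := by nlinarith
    have hbpi : angle x (e u) < Real.pi := by rw [hab]; nlinarith
    have key := hI.ratio_rate (h.ne u ⟨hu0.1.le, hu0.2⟩) hm0 (hr2.trans_lt hm') (hw.trans hr1)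
      hαm hx hab
    have hx1 : ∀ᶠ _ in 𝓝 u, ‖x‖ = 1 := Eventually.of_forall fun _ => hx
    have da := hasDerivAt_angle (hasDerivAt_const u x) hp hx1 (h.eventually_norm_p hu0) hau hapi
    have db := hasDerivAt_angle (hasDerivAt_const u x) he hx1 (h.eventually_norm_e hu0) hb0 hbpi
    refine ⟨_, db.div da hau.ne', ?_⟩
    refine div_nonneg ?_ (sq_nonneg _)
    rw [inner_zero_left, inner_zero_left, add_zero, add_zero, real_inner_smul_right,
      real_inner_smul_right, real_inner_comm w x, real_inner_comm v x]
    have e1 : -(κ * inner ℝ w x / Real.sin (angle x (e u))) * angle x (p u) -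
        angle x (e u) * -(κ * inner ℝ v x / Real.sin (angle x (p u))) =
        κ * angle x (p u) * (m * (inner ℝ v x / Real.sin (angle x (p u))) -
          inner ℝ w x / Real.sin (angle x (e u))) := by
      nth_rewrite 2 [hab]
      ring
    rw [e1]
    exact mul_nonneg (by positivity) (sub_nonneg.2 key)

/-- `ratio_monotone` needs the ratio in a window `[μ, m']` whose upper end still satisfies the
angular condition. At times `s > 0` the distance has strictly decreased, which provides such an `m'
> μ`. Just before the first time `t₀` at which the ratio is at most `μ`, it lies in this window and
exceeds `μ`, so it could not have dropped. -/
theorem lt_of_lt (h : UnitPursuit κ μ T p e) (hκ : 0 < κ) (hμ0 : 0 < μ) (hμ : μ < 1)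
    (h0 : angle (p 0) (e 0) ≤ (1 - μ) / (1 + μ) * Real.pi) {s t : ℝ} (hs : 0 < s) (hst : s ≤ t)
    (ht : t < T) {x : E3} (hx : ‖x‖ = 1) (hxs : μ * angle x (p s) < angle x (e s)) :
    μ * angle x (p t) < angle x (e t) := by
  have hpi := Real.pi_pos
  by_contra hcon
  rw [not_lt] at hcon
  have hsT : s < T := hst.trans_lt ht
  have hdec : ∀ u ∈ Icc s t, angle (p u) (e u) ≤ angle (p s) (e s) := by
    intro u hu
    have h1 := h.angle_add_le hκ hμ0 hμ h0 hs.le hu.1 (hu.2.trans ht.le)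
    have := mul_nonneg (mul_pos hκ (approachSpeed_pos hμ0 hμ)).le (sub_nonneg.2 hu.1)
    linarith
  have hαs : angle (p s) (e s) < (1 - μ) / (1 + μ) * Real.pi := by
    have h1 := h.angle_add_le hκ hμ0 hμ h0 le_rfl hs.le hsT.le
    have := mul_pos (mul_pos hκ (approachSpeed_pos hμ0 hμ)) (sub_pos.2 hs)
    linarith
  have hαpos : 0 < angle (p s) (e s) := h.angle_pos ⟨hs.le, hsT⟩
  set α := angle (p s) (e s) with hα
  -- The solution of `(1 - m') / (1 + m') * π = α`; it exceeds `μ` because `α` is strictly below the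
  -- angular bound.
  set m' := (Real.pi - α) / (Real.pi + α) with hm'
  have hk : (1 - m') / (1 + m') * Real.pi = α := by
    rw [hm']; field_simp; ring
  have hm'1 : m' < 1 := by rw [hm', div_lt_one (by linarith)]; linarith
  have hμm' : μ < m' := by
    rw [hm', lt_div_iff₀ (by linarith)]
    rw [div_mul_eq_mul_div, lt_div_iff₀ (by linarith)] at hαs
    linarith
  have hsub : Icc s t ⊆ Icc 0 T := Icc_subset_Icc hs.le ht.le
  have hca : ContinuousOn (fun u => angle x (p u)) (Icc s t) :=
    ((h.lipschitzOnWith_angle_p hκ.le hx).mono hsub).continuousOn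
  have hcb : ContinuousOn (fun u => angle x (e u)) (Icc s t) :=
    ((h.lipschitzOnWith_angle_e hκ.le hx).mono hsub).continuousOn
  set S := Icc s t ∩ (fun u => angle x (e u) - μ * angle x (p u)) ⁻¹' Iic 0 with hS
  have hSclosed : IsClosed S :=
    (hcb.sub (hca.const_mul μ)).preimage_isClosed_of_isClosed isClosed_Icc isClosed_Iic
  have hScompact : IsCompact S := isCompact_Icc.of_isClosed_subset hSclosed inter_subset_left
  have hSne : S.Nonempty := ⟨t, ⟨hst, le_rfl⟩, sub_nonpos.2 hcon⟩
  have ht0 := hScompact.sInf_mem hSne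
  set t₀ := sInf S with ht₀
  have hle0 : angle x (e t₀) ≤ μ * angle x (p t₀) := sub_nonpos.1 ht0.2
  have hst0 : s < t₀ := by
    refine lt_of_le_of_ne ht0.1.1 fun heq => ?_
    rw [← heq] at hle0
    linarith
  have hgt : ∀ u ∈ Ico s t₀, μ * angle x (p u) < angle x (e u) := by
    intro u hu
    by_contra hle
    have : t₀ ≤ u := csInf_le hScompact.bddBelow
      ⟨⟨hu.1, hu.2.le.trans ht0.1.2⟩, sub_nonpos.2 (not_lt.1 hle)⟩
    linarith [hu.2]
  have ht0T : t₀ ∈ Ico 0 T := ⟨hs.le.trans ht0.1.1, ht0.1.2.trans_lt ht⟩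
  have ha0 : 0 < angle x (p t₀) := by
    refine (angle_nonneg _ _).lt_of_ne fun hz => h.ne t₀ ht0T ?_
    rw [← hz, mul_zero] at hle0
    rw [← eq_of_angle_eq_zero_of_norm_eq hz.symm
      (hx.trans (h.norm_p t₀ ⟨ht0T.1, ht0T.2.le⟩).symm)]
    exact eq_of_angle_eq_zero_of_norm_eq (le_antisymm hle0 (angle_nonneg _ _))
      (hx.trans (h.norm_e t₀ ⟨ht0T.1, ht0T.2.le⟩).symm)
  have hr0 : angle x (e t₀) / angle x (p t₀) ≤ μ := by
    rw [div_le_iff₀ ha0]; exact hle0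
  have hev1 : ∀ᶠ u in 𝓝[Icc s t] t₀, 0 < angle x (p u) :=
    (hca t₀ ht0.1).eventually_const_lt ha0
  have hev2 : ∀ᶠ u in 𝓝[Icc s t] t₀, angle x (e u) / angle x (p u) < m' :=
    ((hcb t₀ ht0.1).div (hca t₀ ht0.1) ha0.ne').eventually_lt_const (hr0.trans_lt hμm')
  have hev := hev1.and hev2
  rw [eventually_nhdsWithin_iff, Metric.eventually_nhds_iff] at hev
  obtain ⟨ε, hε, hev⟩ := hev
  obtain ⟨s', h1, h2⟩ := exists_between (max_lt hst0 (show t₀ - ε < t₀ by linarith))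
  have h1s := (le_max_left _ _).trans_lt h1
  have h1ε := (le_max_right _ _).trans_lt h1
  have hnear : ∀ u ∈ Icc s' t₀, 0 < angle x (p u) ∧ angle x (e u) / angle x (p u) < m' := by
    intro u hu
    refine hev ?_ ⟨h1s.le.trans hu.1, hu.2.trans ht0.1.2⟩
    rw [Real.dist_eq, abs_sub_comm, abs_of_nonneg (by linarith [hu.2])]
    linarith [hu.1]
  have hge : ∀ u ∈ Ioo s' t₀, μ ≤ angle x (e u) / angle x (p u) := by
    intro u hu
    rw [le_div_iff₀ (hnear u ⟨hu.1.le, hu.2.le⟩).1]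
    exact (hgt u ⟨h1s.le.trans hu.1.le, hu.2⟩).le
  have := h.ratio_monotone hκ hμ0 hm'1 (hs.le.trans h1s.le) h2.le ht0T.2
    (fun u hu => by rw [hk]; exact hdec u ⟨h1s.le.trans hu.1, hu.2.trans ht0.1.2⟩) hx
    (fun u hu => (hnear u hu).1)
    (fun u hu => ⟨hge u hu, (hnear u ⟨hu.1.le, hu.2.le⟩).2.le⟩)
  have h3 := hgt s' ⟨h1s.le, h2⟩
  rw [← lt_div_iff₀ (hnear s' ⟨le_rfl, h2.le⟩).1] at h3
  linarith

end UnitPursuit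

/-! ### Capture and monotonicity of the Apollonius domain -/

namespace UnitPursuit

variable {κ μ T : ℝ} {p e : ℝ → E3}

/-- The contrapositive of `lt_of_lt` at times after `s`; the limit at `s` includes the initial time,
which `lt_of_lt` excludes. -/
theorem le_of_le_of_lt (h : UnitPursuit κ μ T p e) (hκ : 0 < κ) (hμ0 : 0 < μ) (hμ : μ < 1)
    (h0 : angle (p 0) (e 0) ≤ (1 - μ) / (1 + μ) * Real.pi) {s t : ℝ} (hs : 0 ≤ s) (hst : s ≤ t)
    (ht : t < T) {x : E3} (hx : ‖x‖ = 1) (hxt : angle x (e t) ≤ μ * angle x (p t)) :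
    angle x (e s) ≤ μ * angle x (p s) := by
  rcases hst.lt_or_eq with hlt | rfl
  swap
  · exact hxt
  have hpos : ∀ u ∈ Ioo s t, angle x (e u) ≤ μ * angle x (p u) := by
    intro u hu
    by_contra hcon
    exact absurd hxt (not_le.2 (h.lt_of_lt hκ hμ0 hμ h0 (hs.trans_lt hu.1) hu.2.le ht hx
      (not_le.1 hcon)))
  have hsub : Ioo s t ⊆ Icc 0 T := fun u hu => ⟨hs.trans hu.1.le, hu.2.le.trans ht.le⟩
  have hsT : s ∈ Icc 0 T := ⟨hs, hst.trans ht.le⟩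
  have ha := ((h.lipschitzOnWith_angle_p hκ.le hx).continuousOn s hsT).mono hsub
  have hb := ((h.lipschitzOnWith_angle_e hκ.le hx).continuousOn s hsT).mono hsub
  have hcl : s ∈ closure (Ioo s t) := by rw [closure_Ioo hlt.ne]; exact ⟨le_rfl, hlt.le⟩
  have := mem_closure_iff_nhdsWithin_neBot.1 hcl
  exact le_of_tendsto_of_tendsto hb (ha.const_mul μ)
    (eventually_nhdsWithin_of_forall fun u hu => hpos u hu)

/-- At capture the domain collapses to the evader's position. At an earlier time `u` the point `e u`
belongs to its own domain, hence to the one at time `s`; the limit `u → T` gives the claim. -/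
theorem le_of_le_of_capture (h : UnitPursuit κ μ T p e) (hκ : 0 < κ) (hμ0 : 0 < μ) (hμ : μ < 1)
    (h0 : angle (p 0) (e 0) ≤ (1 - μ) / (1 + μ) * Real.pi) (hT : p T = e T) {s t : ℝ}
    (hs : 0 ≤ s) (hst : s ≤ t) (ht : t ≤ T) {x : E3} (hx : ‖x‖ = 1)
    (hxt : angle x (e t) ≤ μ * angle x (p t)) : angle x (e s) ≤ μ * angle x (p s) := by
  rcases ht.lt_or_eq with hlt | rfl
  · exact h.le_of_le_of_lt hκ hμ0 hμ h0 hs hst hlt hx hxt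
  rcases hst.lt_or_eq with hlt | rfl
  swap
  · exact hxt
  have ht0 : t ∈ Icc 0 t := ⟨hs.trans hst, le_rfl⟩
  have hxe : x = e t := by
    rw [hT] at hxt
    have h1 := angle_nonneg x (e t)
    exact eq_of_angle_eq_zero_of_norm_eq (by nlinarith) (hx.trans (h.norm_e t ht0).symm)
  subst hxe
  have hpos : ∀ u ∈ Ioo s t, angle (e u) (e s) ≤ μ * angle (e u) (p s) := by
    intro u hu
    have hu0 : u ∈ Icc 0 t := ⟨hs.trans hu.1.le, hu.2.le⟩
    have hnu := h.norm_e u hu0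
    refine h.le_of_le_of_lt hκ hμ0 hμ h0 hs hu.1.le hu.2 hnu ?_
    rw [angle_self (by rw [← norm_ne_zero_iff, hnu]; exact one_ne_zero)]
    exact mul_nonneg hμ0.le (angle_nonneg _ _)
  have hs0 : s ∈ Icc 0 t := ⟨hs, hst⟩
  have hsub : Ioo s t ⊆ Icc 0 t := fun u hu => ⟨hs.trans hu.1.le, hu.2.le⟩
  have ha := ((h.lipschitzOnWith_angle_e hκ.le (h.norm_p s hs0)).continuousOn t ht0).mono hsub
  have hb := ((h.lipschitzOnWith_angle_e hκ.le (h.norm_e s hs0)).continuousOn t ht0).mono hsub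
  have hcl : t ∈ closure (Ioo s t) := by rw [closure_Ioo hlt.ne]; exact ⟨hlt.le, le_rfl⟩
  have := mem_closure_iff_nhdsWithin_neBot.1 hcl
  rw [angle_comm _ (e s), angle_comm _ (p s)]
  refine le_of_tendsto_of_tendsto hb (ha.const_mul μ)
    (eventually_nhdsWithin_of_forall fun u hu => ?_)
  simp only [angle_comm (e s), angle_comm (p s)]
  exact hpos u hu

end UnitPursuit

/-! ### Motions on the sphere of radius `R` and capture -/

namespace IsMotion

variable {R c : ℝ} {X₀ : E3} {X : ℝ → E3}

theorem norm_eq (h : IsMotion R c X₀ X) {t : ℝ} (ht : 0 ≤ t) : ‖X t‖ = R :=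
  mem_sphere_zero_iff_norm.1 (h.mem t ht)

theorem dist_le (h : IsMotion R c X₀ X) {s t : ℝ} (hs : 0 ≤ s) (ht : 0 ≤ t) :
    dist (X s) (X t) ≤ c * |s - t| := by
  rcases le_total s t with hst | hst
  · rw [abs_sub_comm, abs_of_nonneg (sub_nonneg.2 hst)]; exact h.lip s t hs hst
  · rw [dist_comm, abs_of_nonneg (sub_nonneg.2 hst)]; exact h.lip t s ht hst

theorem norm_deriv_le (h : IsMotion R c X₀ X) (hc : 0 ≤ c) {t : ℝ} (ht : 0 < t) {w : E3}
    (hw : HasDerivAt X w t) : ‖w‖ ≤ c := by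
  refine hw.le_of_lip' hc ?_
  filter_upwards [Ioi_mem_nhds ht] with s hs
  rw [← dist_eq_norm, Real.norm_eq_abs]
  exact h.dist_le (le_of_lt hs) ht.le

theorem inner_deriv (h : IsMotion R c X₀ X) {t : ℝ} (ht : 0 < t) {w : E3}
    (hw : HasDerivAt X w t) : inner ℝ w (X t) = 0 := by
  have h1 := hw.norm_sq
  have h2 : HasDerivAt (fun s => ‖X s‖ ^ 2) 0 t := by
    refine (hasDerivAt_const t (R ^ 2)).congr_of_eventuallyEq ?_
    filter_upwards [Ioi_mem_nhds ht] with s hs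
    rw [h.norm_eq (le_of_lt hs)]
  have h3 := h1.unique h2
  rw [real_inner_comm]
  linarith

end IsMotion

theorem unitPursuit_of_strategy {R vP μ T : ℝ} (hR : 0 < R) (hvP : 0 < vP) (hμ0 : 0 < μ)
    (hμ : μ < 1) {P₀ E₀ : E3} {P E : ℝ → E3} (hP : IsMotion R vP P₀ P)
    (hE : IsMotion R (μ * vP) E₀ E) (hne : ∀ t ∈ Ico 0 T, P t ≠ E t)
    (hstr : ∀ᵐ t : ℝ, t ∈ Ioo 0 T → ∃ w v : E3, HasDerivAt E w t ∧ HasDerivAt P v t ∧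
      IsGeodesicParallelVelocity R vP (P t) (E t) w v) :
    UnitPursuit (vP / R) μ T (fun t => R⁻¹ • P t) (fun t => R⁻¹ • E t) where
  norm_p t ht := norm_inv_smul_eq_one hR (hP.norm_eq ht.1)
  norm_e t ht := norm_inv_smul_eq_one hR (hE.norm_eq ht.1)
  lip_p s hs t ht := by
    rw [← smul_sub, norm_smul, Real.norm_of_nonneg (inv_nonneg.2 hR.le), ← dist_eq_norm]
    have := mul_le_mul_of_nonneg_left (hP.dist_le hs.1 ht.1) (inv_nonneg.2 hR.le)
    rwa [← mul_assoc, inv_mul_eq_div R vP] at this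
  lip_e s hs t ht := by
    rw [← smul_sub, norm_smul, Real.norm_of_nonneg (inv_nonneg.2 hR.le), ← dist_eq_norm]
    have h1 : dist (E s) (E t) ≤ vP * |s - t| :=
      (hE.dist_le hs.1 ht.1).trans
        (mul_le_mul_of_nonneg_right (by nlinarith) (abs_nonneg _))
    have := mul_le_mul_of_nonneg_left h1 (inv_nonneg.2 hR.le)
    rwa [← mul_assoc, inv_mul_eq_div R vP] at this
  ne t ht heq := hne t ht (smul_right_injective E3 (inv_ne_zero hR.ne') heq)
  strategy := by
    filter_upwards [hstr] with t ht htT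
    obtain ⟨w, v, hw, hv, hg⟩ := ht htT
    obtain ⟨τ, hτ⟩ := hg.unitIntercept hR hvP (hP.norm_eq htT.1.le) (hE.norm_eq htT.1.le)
      (hE.inner_deriv htT.1 hw)
    have e1 : ∀ z : E3, (vP / R) • vP⁻¹ • z = R⁻¹ • z := fun z => by
      rw [smul_smul]; congr 1; field_simp
    refine ⟨vP⁻¹ • w, vP⁻¹ • v, τ, ?_, ?_, ?_, hτ⟩
    · rw [e1]; exact hv.fun_const_smul R⁻¹
    · rw [e1]; exact hw.fun_const_smul R⁻¹
    · rw [norm_smul, Real.norm_of_nonneg (inv_nonneg.2 hvP.le), inv_mul_le_iff₀ hvP, mul_comm]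
      exact hE.norm_deriv_le (by positivity) htT.1 hw

theorem mem_apolloniusDomain_iff {R vP μ : ℝ} (hR : 0 < R) (hvP : 0 < vP) (hμ0 : 0 < μ)
    {P E x : E3} :
    x ∈ apolloniusDomain R vP μ P E ↔ ‖x‖ = R ∧ angle x E ≤ μ * angle x P := by
  rw [apolloniusDomain, mem_ofPred_eq, mem_sphere_zero_iff_norm]
  refine and_congr_right fun _ => ?_
  rw [arcLen, arcLen, angDist, angDist, div_le_div_iff₀ (by positivity) hvP]
  constructor
  · intro h
    have : R * vP * angle x E ≤ R * vP * (μ * angle x P) := by linarith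
    exact le_of_mul_le_mul_left this (by positivity)
  · intro h
    have := mul_le_mul_of_nonneg_left h (show 0 ≤ R * vP by positivity)
    linarith

/-- A time by which the evader is captured. -/
def captureBound (R vP μ : ℝ) : ℝ := Real.pi / (vP / R * approachSpeed μ)

theorem UnitPursuit.le_captureBound {R vP μ T : ℝ} (hR : 0 < R) (hvP : 0 < vP) (hμ0 : 0 < μ)
    (hμ : μ < 1) {p e : ℝ → E3} (h : UnitPursuit (vP / R) μ T p e) (hT : 0 ≤ T)
    (h0 : angle (p 0) (e 0) ≤ (1 - μ) / (1 + μ) * Real.pi) : T ≤ captureBound R vP μ := by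
  have h1 := h.angle_add_le (by positivity) hμ0 hμ h0 le_rfl hT le_rfl
  have h2 := angle_nonneg (p T) (e T)
  have h3 := angle_le_pi (p 0) (e 0)
  have hpos := approachSpeed_pos hμ0 hμ
  rw [captureBound, le_div_iff₀ (by positivity)]
  linarith

theorem exists_capture {R vP μ : ℝ} (hR : 0 < R) (hvP : 0 < vP) (hμ0 : 0 < μ) (hμ : μ < 1)
    {P₀ E₀ : E3} (hα : angDist P₀ E₀ ≤ (1 - μ) / (1 + μ) * Real.pi) {P E : ℝ → E3}
    (hE : IsMotion R (μ * vP) E₀ E) (hP : IsGeodesicParallelResponse R vP P₀ E P) :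
    ∃ tc, IsCaptureTime P E tc ∧ tc ≤ captureBound R vP μ ∧
      (∀ s t, 0 ≤ s → s ≤ t → t ≤ tc →
        apolloniusDomain R vP μ (P t) (E t) ⊆ apolloniusDomain R vP μ (P s) (E s)) := by
  have hpi := Real.pi_pos
  have hκ : 0 < vP / R := by positivity
  have hU : ∀ T, (∀ t ∈ Ico 0 T, P t ≠ E t) →
      UnitPursuit (vP / R) μ T (fun t => R⁻¹ • P t) (fun t => R⁻¹ • E t) := by
    intro T hne
    refine unitPursuit_of_strategy hR hvP hμ0 hμ hP.motion hE hne ?_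
    filter_upwards [hP.strategy] with t ht htT
    exact ht htT.1 fun s hs => hne s ⟨hs.1, hs.2.trans_lt htT.2⟩
  have h0 : angle (R⁻¹ • P 0) (R⁻¹ • E 0) ≤ (1 - μ) / (1 + μ) * Real.pi := by
    rw [angle_inv_smul hR, hP.motion.init, hE.init]; exact hα
  have hB : 0 < captureBound R vP μ := by
    have := approachSpeed_pos hμ0 hμ
    unfold captureBound
    positivity
  have hcP : ContinuousOn P (Icc 0 (captureBound R vP μ + 1)) :=
    (LipschitzOnWith.of_dist_le_mul (K := Real.toNNReal vP) fun s hs t ht => by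
      rw [Real.coe_toNNReal _ hvP.le]; exact hP.motion.dist_le hs.1 ht.1).continuousOn
  have hcE : ContinuousOn E (Icc 0 (captureBound R vP μ + 1)) :=
    (LipschitzOnWith.of_dist_le_mul (K := Real.toNNReal (μ * vP)) fun s hs t ht => by
      rw [Real.coe_toNNReal _ (by positivity)]; exact hE.dist_le hs.1 ht.1).continuousOn
  set S := Icc 0 (captureBound R vP μ + 1) ∩ (fun t => P t - E t) ⁻¹' {0} with hS
  have hSclosed : IsClosed S :=
    (hcP.sub hcE).preimage_isClosed_of_isClosed isClosed_Icc isClosed_singleton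
  have hScompact : IsCompact S := isCompact_Icc.of_isClosed_subset hSclosed inter_subset_left
  -- Without capture on an interval longer than `captureBound`, `UnitPursuit.le_captureBound` would
  -- be violated.
  have hSne : S.Nonempty := by
    by_contra hemp
    have := (hU (captureBound R vP μ + 1) fun t ht heq =>
      hemp ⟨t, ⟨ht.1, ht.2.le⟩, sub_eq_zero.2 heq⟩).le_captureBound hR hvP hμ0 hμ
        (by linarith) h0
    linarith
  have htc := hScompact.sInf_mem hSne
  set tc := sInf S with htc_def
  have hcap : P tc = E tc := sub_eq_zero.1 htc.2
  have hfirst : ∀ s, 0 ≤ s → s < tc → P s ≠ E s := fun s hs hlt heq =>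
    absurd (csInf_le hScompact.bddBelow
      (⟨⟨hs, hlt.le.trans htc.1.2⟩, sub_eq_zero.2 heq⟩ : s ∈ S)) (not_le.2 hlt)
  have hUtc := hU tc fun t ht => hfirst t ht.1 ht.2
  refine ⟨tc, ⟨htc.1.1, hcap, hfirst⟩, hUtc.le_captureBound hR hvP hμ0 hμ htc.1.1 h0, ?_⟩
  intro s t hs hst ht x hx
  rw [mem_apolloniusDomain_iff hR hvP hμ0] at hx ⊢
  refine ⟨hx.1, ?_⟩
  have := hUtc.le_of_le_of_capture hκ hμ0 hμ h0 (by simp only [hcap]) hs hst ht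
    (norm_inv_smul_eq_one hR hx.1) (by simp only [angle_inv_smul hR]; exact hx.2)
  simpa only [angle_inv_smul hR] using this

theorem mem_apolloniusDomain_self {R vP μ : ℝ} (hR : 0 < R) (hvP : 0 < vP) (hμ0 : 0 < μ)
    {P E : E3} (hE : ‖E‖ = R) : E ∈ apolloniusDomain R vP μ P E := by
  rw [mem_apolloniusDomain_iff hR hvP hμ0]
  refine ⟨hE, ?_⟩
  rw [angle_self (by rw [← norm_ne_zero_iff, hE]; exact hR.ne')]
  exact mul_nonneg hμ0.le (angle_nonneg _ _)

/-! ### Differential equations with measurable right-hand side -/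

section Caratheodory

variable {V : Type*} [NormedAddCommGroup V] [InnerProductSpace ℝ V] [MeasurableSpace V]

/-- Nodes of the Euler polygon with step size `h` for the equation `x' = F t x`. -/
def eulerNode (F : ℝ → V → V) (x₀ : V) (h : ℝ) : ℕ → V
  | 0 => x₀
  | k + 1 => eulerNode F x₀ h k + ∫ s in (k * h)..((k + 1) * h), F s (eulerNode F x₀ h k)

/-- Piecewise constant approximation to the Euler polygon. -/
def eulerStep (F : ℝ → V → V) (x₀ : V) (h s : ℝ) : V := eulerNode F x₀ h ⌊s / h⌋₊

/-- The Euler polygon with step size `h` for the equation `x' = F t x`. -/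
def eulerPath (F : ℝ → V → V) (x₀ : V) (h t : ℝ) : V :=
  x₀ + ∫ s in 0..t, F s (eulerStep F x₀ h s)

theorem measurable_eulerStep (F : ℝ → V → V) (x₀ : V) (h : ℝ) :
    Measurable (eulerStep F x₀ h) :=
  (measurable_from_top (f := eulerNode F x₀ h)).comp
    (Nat.measurable_floor.comp (measurable_id.div_const h))

variable {F : ℝ → V → V} {M : ℝ}

theorem measurable_eulerStep_comp (hF : Measurable (Function.uncurry F)) (x₀ : V) (h : ℝ) :
    Measurable fun s => F s (eulerStep F x₀ h s) :=
  hF.comp (measurable_id.prodMk (measurable_eulerStep F x₀ h))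

variable [FiniteDimensional ℝ V] [BorelSpace V]

theorem Measurable.intervalIntegrable_of_norm_le {g : ℝ → V} {M : ℝ} (hg : Measurable g)
    (hM : ∀ s, ‖g s‖ ≤ M) (a b : ℝ) : IntervalIntegrable g volume a b :=
  (intervalIntegrable_const (c := M)).mono_fun hg.aestronglyMeasurable
    (Eventually.of_forall fun s => (hM s).trans (le_abs_self M))

theorem norm_integral_sub_le {g : ℝ → V} {M : ℝ} (hg : Measurable g) (hM : ∀ s, ‖g s‖ ≤ M)
    (a s t : ℝ) : ‖(∫ u in a..s, g u) - ∫ u in a..t, g u‖ ≤ M * |s - t| := by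
  rw [intervalIntegral.integral_interval_sub_left (hg.intervalIntegrable_of_norm_le hM _ _)
    (hg.intervalIntegrable_of_norm_le hM _ _)]
  exact intervalIntegral.norm_integral_le_of_norm_le_const fun u _ => hM u

theorem norm_eulerPath_sub_le (hF : Measurable (Function.uncurry F)) (hM : ∀ t x, ‖F t x‖ ≤ M)
    (x₀ : V) (h s t : ℝ) : ‖eulerPath F x₀ h s - eulerPath F x₀ h t‖ ≤ M * |s - t| := by
  rw [eulerPath, eulerPath, add_sub_add_left_eq_sub]
  exact norm_integral_sub_le (measurable_eulerStep_comp hF x₀ h) (fun s => hM _ _) 0 s t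

theorem eulerPath_node (hF : Measurable (Function.uncurry F)) (hM : ∀ t x, ‖F t x‖ ≤ M)
    (x₀ : V) {h : ℝ} (hh : 0 < h) (k : ℕ) : eulerPath F x₀ h (k * h) = eulerNode F x₀ h k := by
  induction k with
  | zero => simp [eulerPath, eulerNode]
  | succ k ih =>
    have hint := (measurable_eulerStep_comp hF x₀ h).intervalIntegrable_of_norm_le
      (fun s => hM _ _)
    rw [eulerNode, ← ih, eulerPath, eulerPath, add_assoc,
      ← intervalIntegral.integral_add_adjacent_intervals (hint 0 (k * h)) (hint _ _)]
    congr 2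
    rw [Nat.cast_succ]
    refine intervalIntegral.integral_congr_ae ?_
    -- At the right endpoint the floor already jumps to `k + 1`; this single point is negligible.
    have hne : ∀ᵐ s : ℝ, s ≠ (k + 1) * h := by simp [ae_iff, measure_singleton]
    filter_upwards [hne] with s hs hsm
    rw [uIoc_of_le (by nlinarith)] at hsm
    have hfl : ⌊s / h⌋₊ = k := by
      rw [Nat.floor_eq_iff (div_nonneg (le_trans (by positivity) hsm.1.le) hh.le)]
      exact ⟨by rw [le_div_iff₀ hh]; exact hsm.1.le,
        by rw [div_lt_iff₀ hh]; exact lt_of_le_of_ne hsm.2 hs⟩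
    rw [eulerStep, hfl, ← ih, eulerPath]

theorem norm_eulerPath_sub_eulerStep_le (hF : Measurable (Function.uncurry F))
    (hM : ∀ t x, ‖F t x‖ ≤ M) (x₀ : V) {h : ℝ} (hh : 0 < h) {s : ℝ} (hs : 0 ≤ s) :
    ‖eulerPath F x₀ h s - eulerStep F x₀ h s‖ ≤ M * h := by
  have hM0 : 0 ≤ M := (norm_nonneg _).trans (hM 0 x₀)
  rw [eulerStep, ← eulerPath_node hF hM x₀ hh]
  refine (norm_eulerPath_sub_le hF hM x₀ h _ _).trans (mul_le_mul_of_nonneg_left ?_ hM0)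
  have h1 := Nat.floor_le (div_nonneg hs hh.le)
  have h2 := Nat.lt_floor_add_one (s / h)
  rw [le_div_iff₀ hh] at h1
  rw [div_lt_iff₀ hh] at h2
  rw [abs_of_nonneg (by linarith)]
  linarith

/-- For a bounded measurable right-hand side there is a Lipschitz path that solves the
integral equation as long as the right-hand side is continuous in the state along the path. -/
theorem exists_integral_solution (hF : Measurable (Function.uncurry F))
    (hM : ∀ t x, ‖F t x‖ ≤ M) (x₀ : V) {T : ℝ} (hT : 0 ≤ T) :
    ∃ X : ℝ → V, X 0 = x₀ ∧ (∀ s t, ‖X s - X t‖ ≤ M * |s - t|) ∧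
      ∀ t ∈ Icc 0 T, (∀ᵐ s : ℝ, s ∈ Ioo 0 t → ContinuousAt (F s) (X s)) →
        X t = x₀ + ∫ s in 0..t, F s (X s) := by
  have hM0 : 0 ≤ M := (norm_nonneg _).trans (hM 0 x₀)
  set h : ℕ → ℝ := fun n => 1 / ((n : ℝ) + 1) with hh
  have hhpos : ∀ n, 0 < h n := fun n => Nat.one_div_pos_of_nat
  have hlip : ∀ n, LipschitzWith (Real.toNNReal M)
      (fun t : Icc (0 : ℝ) T => eulerPath F x₀ (h n) t) := fun n =>
    LipschitzWith.of_dist_le_mul fun s t => by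
      rw [Real.coe_toNNReal _ hM0, dist_eq_norm]
      exact norm_eulerPath_sub_le hF hM x₀ (h n) s t
  set f : ℕ → BoundedContinuousFunction (Icc (0 : ℝ) T) V := fun n =>
    BoundedContinuousFunction.mkOfCompact ⟨_, (hlip n).continuous⟩ with hf
  have hfa : ∀ n (t : Icc (0 : ℝ) T), f n t = eulerPath F x₀ (h n) t := fun n t => rfl
  have hcomp : IsCompact (closure (range f)) := by
    refine BoundedContinuousFunction.arzela_ascoli (Metric.closedBall x₀ (M * T))
      (isCompact_closedBall _ _) (range f) ?_ ?_
    · rintro _ t ⟨n, rfl⟩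
      rw [hfa, mem_closedBall_iff_norm]
      have h1 := norm_eulerPath_sub_le hF hM x₀ (h n) t 0
      have h2 : eulerPath F x₀ (h n) 0 = x₀ := by simp [eulerPath]
      rw [h2, sub_zero, abs_of_nonneg t.2.1] at h1
      exact h1.trans (mul_le_mul_of_nonneg_left t.2.2 hM0)
    · refine UniformEquicontinuous.equicontinuous ?_
      refine LipschitzWith.uniformEquicontinuous _ (Real.toNNReal M) ?_
      rintro ⟨_, n, rfl⟩
      exact hlip n
  obtain ⟨g, -, φ, hφ, hlim⟩ := hcomp.tendsto_subseq fun n => subset_closure (mem_range_self n)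
  have hpt : ∀ t : Icc (0 : ℝ) T,
      Tendsto (fun n => eulerPath F x₀ (h (φ n)) t) atTop (𝓝 (g t)) := fun t =>
    ((continuous_eval_const t).tendsto g).comp hlim
  -- The uniform limit is defined on `[0, T]` only; the constant extension beyond the endpoints
  -- keeps its Lipschitz constant.
  set X : ℝ → V := fun t => g (projIcc 0 T hT t) with hX
  have hXlim : ∀ t ∈ Icc 0 T, Tendsto (fun n => eulerPath F x₀ (h (φ n)) t) atTop (𝓝 (X t)) := by
    intro t ht
    have := hpt ⟨t, ht⟩
    rw [hX]
    simp only [projIcc_of_mem hT ht]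
    exact this
  refine ⟨X, ?_, ?_, ?_⟩
  · refine tendsto_nhds_unique (hXlim 0 ⟨le_rfl, hT⟩) ?_
    simp [eulerPath]
  · have hIcc : ∀ s ∈ Icc 0 T, ∀ t ∈ Icc 0 T, ‖X s - X t‖ ≤ M * |s - t| := fun s hs t ht =>
      le_of_tendsto ((hXlim s hs).sub (hXlim t ht)).norm
      (Eventually.of_forall fun n => norm_eulerPath_sub_le hF hM x₀ _ s t)
    intro s t
    have hproj : ∀ u, X u = X (projIcc 0 T hT u) := fun u => by
      simp only [hX, projIcc_val]
    rw [hproj s, hproj t]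
    refine (hIcc _ (projIcc 0 T hT s).2 _ (projIcc 0 T hT t).2).trans
      (mul_le_mul_of_nonneg_left ?_ hM0)
    have := (LipschitzWith.projIcc hT).dist_le_mul s t
    simpa [Subtype.dist_eq, Real.dist_eq] using this
  · intro t ht hc
    refine tendsto_nhds_unique (hXlim t ht) ?_
    refine Tendsto.const_add _ ?_
    -- The frozen states are within `M * h` of the polygons and so converge to `X s` as well.
    -- Continuity of `F s` is needed at this limit only.
    refine intervalIntegral.tendsto_integral_filter_of_dominated_convergence (fun _ => M) ?_ ?_
      intervalIntegrable_const ?_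
    · exact Eventually.of_forall fun n =>
        (measurable_eulerStep_comp hF x₀ (h (φ n))).aestronglyMeasurable
    · exact Eventually.of_forall fun n => Eventually.of_forall fun s _ => hM _ _
    · have hne : ∀ᵐ s : ℝ, s ≠ t := by simp [ae_iff, measure_singleton]
      filter_upwards [hc, hne] with s hs hst hsm
      rw [uIoc_of_le ht.1] at hsm
      have hsI : s ∈ Icc 0 T := ⟨hsm.1.le, hsm.2.trans ht.2⟩
      refine (hs ⟨hsm.1, lt_of_le_of_ne hsm.2 hst⟩).tendsto.comp ?_
      have h0 : Tendsto (fun n => M * h (φ n)) atTop (𝓝 0) := by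
        have := (tendsto_one_div_add_atTop_nhds_zero_nat (𝕜 := ℝ)).comp hφ.tendsto_atTop
        simpa [hh] using this.const_mul M
      have h1 : Tendsto (fun n => eulerPath F x₀ (h (φ n)) s - eulerStep F x₀ (h (φ n)) s) atTop
          (𝓝 0) :=
        squeeze_zero_norm (fun n => norm_eulerPath_sub_eulerStep_le hF hM x₀ (hhpos _) hsI.1) h0
      simpa using (hXlim s hsI).sub h1

end Caratheodory

/-! ### The velocity field of the geodesic parallel strategy -/

theorem continuous_geodesicArc :
    Continuous fun q : E3 × E3 × ℝ => geodesicArc q.1 q.2.1 q.2.2 := by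
  have := Real.continuous_sinc
  unfold geodesicArc
  fun_prop

theorem continuousAt_angle_geodesicArc {p e w : E3} (hp : p ≠ 0) (he : ‖e‖ = 1)
    (hwe : inner ℝ w e = 0) (τ : ℝ) :
    ContinuousAt (fun q : E3 × E3 × E3 × ℝ => angle (geodesicArc q.2.1 q.2.2.1 q.2.2.2) q.1)
      (p, e, w, τ) := by
  have h1 : geodesicArc e w τ ≠ 0 := by
    rw [← norm_ne_zero_iff, norm_geodesicArc he hwe]; exact one_ne_zero
  have h2 : Continuous fun q : E3 × E3 × E3 × ℝ =>
      (geodesicArc q.2.1 q.2.2.1 q.2.2.2, q.1) :=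
    (continuous_geodesicArc.comp continuous_snd).prodMk continuous_fst
  have h3 : ContinuousAt (fun y : E3 × E3 => angle y.1 y.2) (geodesicArc e w τ, p) :=
    continuousAt_angle h1 hp
  exact ContinuousAt.comp_of_eq (g := fun y : E3 × E3 => angle y.1 y.2)
    (f := fun q : E3 × E3 × E3 × ℝ => (geodesicArc q.2.1 q.2.2.1 q.2.2.2, q.1))
    h3 h2.continuousAt rfl

/-- Positions of pursuer and evader on rays from the origin that are neither coincident nor too
far from each other. -/
def pursuitPositions (μ : ℝ) : Set (E3 × E3) :=
  {q | (q.1 ≠ 0 ∧ q.2 ≠ 0) ∧ angle q.1 q.2 ∈ Ioo 0 ((1 - μ) * Real.pi)}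

theorem isOpen_pursuitPositions (μ : ℝ) : IsOpen (pursuitPositions μ) := by
  have h1 : IsOpen {q : E3 × E3 | q.1 ≠ 0 ∧ q.2 ≠ 0} :=
    (isOpen_ne.preimage continuous_fst).inter (isOpen_ne.preimage continuous_snd)
  exact ContinuousOn.isOpen_inter_preimage
    (fun q hq => (continuousAt_angle hq.1 hq.2).continuousWithinAt) h1 isOpen_Ioo

/-- Pursuer position, evader position and evader velocity for which the strategy is uniquely
defined. -/
def pursuitStates (μ : ℝ) : Set (E3 × E3 × E3) :=
  {q | (q.1, q.2.1) ∈ pursuitPositions μ ∧ ‖q.2.1‖ = 1 ∧ inner ℝ q.2.2 q.2.1 = 0 ∧ ‖q.2.2‖ ≤ μ}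

theorem measurableSet_pursuitStates (μ : ℝ) : MeasurableSet (pursuitStates μ) := by
  have h1 : MeasurableSet {q : E3 × E3 × E3 | (q.1, q.2.1) ∈ pursuitPositions μ} :=
    ((isOpen_pursuitPositions μ).preimage
      (continuous_fst.prodMk (continuous_fst.comp continuous_snd))).measurableSet
  have h2 : IsClosed {q : E3 × E3 × E3 | ‖q.2.1‖ = 1} :=
    isClosed_eq (by fun_prop) (by fun_prop)
  have h3 : IsClosed {q : E3 × E3 × E3 | inner ℝ q.2.2 q.2.1 = 0} :=
    isClosed_eq (by fun_prop) (by fun_prop)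
  have h4 : IsClosed {q : E3 × E3 × E3 | ‖q.2.2‖ ≤ μ} :=
    isClosed_le (by fun_prop) (by fun_prop)
  exact h1.inter (h2.measurableSet.inter (h3.measurableSet.inter h4.measurableSet))

/-- The difference `angle (geodesicArc e w τ) p - τ` is nonnegative at `0` and nonpositive at `π`.
-/
theorem exists_interceptTime {p e w : E3} (hp : p ≠ 0) (he : ‖e‖ = 1) (hwe : inner ℝ w e = 0) :
    ∃ τ ∈ Icc 0 Real.pi, angle (geodesicArc e w τ) p = τ := by
  have hc : ContinuousOn (fun τ => angle (geodesicArc e w τ) p - τ) (Icc 0 Real.pi) := by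
    refine Continuous.continuousOn (Continuous.sub ?_ continuous_id)
    refine continuous_iff_continuousAt.2 fun τ => ?_
    exact (continuousAt_angle_geodesicArc hp he hwe τ).comp
      (f := fun τ : ℝ => (p, e, w, τ)) (by fun_prop)
  obtain ⟨τ, hτ, h0⟩ := intermediate_value_Icc' Real.pi_pos.le hc
    (show (0 : ℝ) ∈ _ from ⟨by linarith [angle_le_pi (geodesicArc e w Real.pi) p], by
      rw [sub_zero]; exact angle_nonneg _ _⟩)
  exact ⟨τ, hτ, sub_eq_zero.1 h0⟩

open Classical in
/-- The time to interception. -/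
def interceptTime (q : E3 × E3 × E3) : ℝ :=
  if h : ∃ τ ∈ Icc 0 Real.pi, angle (geodesicArc q.2.1 q.2.2 τ) q.1 = τ then h.choose else 0

theorem interceptTime_spec {q : E3 × E3 × E3} {μ : ℝ} (hq : q ∈ pursuitStates μ) :
    interceptTime q ∈ Icc 0 Real.pi ∧
      angle (geodesicArc q.2.1 q.2.2 (interceptTime q)) q.1 = interceptTime q := by
  have h := exists_interceptTime hq.1.1.1 hq.2.1 hq.2.2.1
  rw [interceptTime, dif_pos h]
  exact h.choose_spec

theorem geodesicArc_zero (e w : E3) : geodesicArc e w 0 = e := by simp [geodesicArc]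

/-- Time `0` would make the angle between the players zero, and time `π` would force it to be at
least `(1 - μ) * π`. This is the reason for the bounds in `pursuitPositions`. -/
theorem interceptTime_mem_Ioo {q : E3 × E3 × E3} {μ : ℝ} (hμ : μ < 1)
    (hq : q ∈ pursuitStates μ) : interceptTime q ∈ Ioo 0 Real.pi := by
  obtain ⟨hI, h⟩ := interceptTime_spec hq
  obtain ⟨⟨⟨hp0, he0⟩, hα0, hα1⟩, he, hwe, hw⟩ := hq
  simp only at *
  set τ := interceptTime q
  constructor
  · refine hI.1.lt_of_ne fun h0 => ?_
    rw [← h0, geodesicArc_zero, angle_comm] at h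
    linarith
  · have h1 := angle_geodesicArc_le he hwe τ 0
    rw [sub_zero, abs_of_nonneg hI.1, geodesicArc_zero] at h1
    have h2 := angle_le_angle_add_angle (geodesicArc q.2.1 q.2.2 τ) q.2.1 q.1
    rw [h, angle_comm q.2.1 q.1] at h2
    have h3 : ‖q.2.2‖ * τ ≤ μ * τ := mul_le_mul_of_nonneg_right hw hI.1
    by_contra hcon
    nlinarith

/-- The angle from the evader's arc to the pursuer is `μ`-Lipschitz in time. Hence `(1 - μ) * |τ -
τ₀|` is at most the error made by `τ₀` in the equation for `τ`, which tends to zero. The same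
contraction makes the chosen root unique. -/
theorem continuousOn_interceptTime {μ : ℝ} (hμ : μ < 1) :
    ContinuousOn interceptTime (pursuitStates μ) := by
  intro q₀ hq₀
  obtain ⟨hI₀, h₀⟩ := interceptTime_spec hq₀
  set τ₀ := interceptTime q₀ with hτ₀
  have hcont : ContinuousAt (fun q : E3 × E3 × E3 => angle (geodesicArc q.2.1 q.2.2 τ₀) q.1) q₀ :=
    (continuousAt_angle_geodesicArc hq₀.1.1.1 hq₀.2.1 hq₀.2.2.1 τ₀).comp
      (f := fun q : E3 × E3 × E3 => (q.1, q.2.1, q.2.2, τ₀)) (by fun_prop)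
  have hlim : Tendsto (fun q : E3 × E3 × E3 =>
      |angle (geodesicArc q.2.1 q.2.2 τ₀) q.1 - τ₀| / (1 - μ)) (𝓝[pursuitStates μ] q₀) (𝓝 0) := by
    have h1 := hcont.tendsto.mono_left (nhdsWithin_le_nhds (s := pursuitStates μ))
    rw [h₀] at h1
    have h2 := ((h1.sub_const τ₀).abs).div_const (1 - μ)
    simpa using h2
  rw [ContinuousWithinAt, tendsto_iff_dist_tendsto_zero]
  refine squeeze_zero' (Eventually.of_forall fun _ => dist_nonneg) ?_ hlim
  filter_upwards [self_mem_nhdsWithin] with q hq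
  obtain ⟨hI, h⟩ := interceptTime_spec hq
  obtain ⟨-, he, hwe, hw⟩ := hq
  rw [le_div_iff₀ (by linarith), Real.dist_eq, ← hτ₀]
  set τ := interceptTime q
  have t1 := angle_geodesicArc_le he hwe τ τ₀
  have t2 := angle_le_angle_add_angle (geodesicArc q.2.1 q.2.2 τ)
    (geodesicArc q.2.1 q.2.2 τ₀) q.1
  have t3 := angle_le_angle_add_angle (geodesicArc q.2.1 q.2.2 τ₀)
    (geodesicArc q.2.1 q.2.2 τ) q.1
  rw [angle_comm (geodesicArc q.2.1 q.2.2 τ₀) (geodesicArc q.2.1 q.2.2 τ)] at t3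
  have hwμ : ‖q.2.2‖ * |τ - τ₀| ≤ μ * |τ - τ₀| := mul_le_mul_of_nonneg_right hw (abs_nonneg _)
  rw [h] at t2 t3
  have b1 := le_abs_self (angle (geodesicArc q.2.1 q.2.2 τ₀) q.1 - τ₀)
  have b2 := neg_abs_le (angle (geodesicArc q.2.1 q.2.2 τ₀) q.1 - τ₀)
  have h5 : |τ - τ₀| ≤ μ * |τ - τ₀| + |angle (geodesicArc q.2.1 q.2.2 τ₀) q.1 - τ₀| :=
    abs_le.2 ⟨by linarith, by linarith⟩
  linarith

open Classical in
/-- The pursuer's velocity prescribed by the strategy on the unit sphere with unit speed; it only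
depends on the ray on which the pursuer's position lies. -/
def pursuitVelocity (μ : ℝ) : E3 × E3 × E3 → E3 :=
  (pursuitStates μ).piecewise (fun q => (Real.sin (interceptTime q))⁻¹ •
    (geodesicArc q.2.1 q.2.2 (interceptTime q) - Real.cos (interceptTime q) • ‖q.1‖⁻¹ • q.1))
    (fun _ => 0)

theorem pursuitVelocity_of_mem {μ : ℝ} {q : E3 × E3 × E3} (hq : q ∈ pursuitStates μ) :
    pursuitVelocity μ q = (Real.sin (interceptTime q))⁻¹ •
      (geodesicArc q.2.1 q.2.2 (interceptTime q) -
        Real.cos (interceptTime q) • ‖q.1‖⁻¹ • q.1) := by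
  classical exact piecewise_eq_of_mem _ _ _ hq

theorem pursuitVelocity_of_notMem {μ : ℝ} {q : E3 × E3 × E3} (hq : q ∉ pursuitStates μ) :
    pursuitVelocity μ q = 0 := by
  classical exact piecewise_eq_of_notMem _ _ _ hq

theorem continuousOn_pursuitVelocity {μ : ℝ} (hμ : μ < 1) :
    ContinuousOn (pursuitVelocity μ) (pursuitStates μ) := by
  have hτ := continuousOn_interceptTime hμ
  have hγ : ContinuousOn (fun q : E3 × E3 × E3 => geodesicArc q.2.1 q.2.2 (interceptTime q))
      (pursuitStates μ) :=
    continuous_geodesicArc.comp_continuousOn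
      (f := fun q : E3 × E3 × E3 => (q.2.1, q.2.2, interceptTime q))
      ((by fun_prop : Continuous fun q : E3 × E3 × E3 => q.2.1).continuousOn.prodMk
        ((by fun_prop : Continuous fun q : E3 × E3 × E3 => q.2.2).continuousOn.prodMk hτ))
  have hn : ContinuousOn (fun q : E3 × E3 × E3 => ‖q.1‖⁻¹ • q.1) (pursuitStates μ) :=
    (ContinuousOn.inv₀ (by fun_prop) fun q hq => norm_ne_zero_iff.2 hq.1.1.1).smul (by fun_prop)
  refine ContinuousOn.congr (f := fun q : E3 × E3 × E3 => (Real.sin (interceptTime q))⁻¹ •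
    (geodesicArc q.2.1 q.2.2 (interceptTime q) - Real.cos (interceptTime q) • ‖q.1‖⁻¹ • q.1)) ?_
    fun q hq => pursuitVelocity_of_mem hq
  refine ContinuousOn.smul (ContinuousOn.inv₀ (Real.continuous_sin.comp_continuousOn hτ)
    fun q hq => ?_) (hγ.sub ((Real.continuous_cos.comp_continuousOn hτ).smul hn))
  have := interceptTime_mem_Ioo hμ hq
  exact (Real.sin_pos_of_pos_of_lt_pi this.1 this.2).ne'

theorem measurable_pursuitVelocity {μ : ℝ} (hμ : μ < 1) : Measurable (pursuitVelocity μ) := by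
  classical
  refine ContinuousOn.measurable_piecewise ((continuousOn_pursuitVelocity hμ).congr ?_)
    continuousOn_const (measurableSet_pursuitStates μ)
  exact fun q hq => (pursuitVelocity_of_mem hq).symm

theorem unitIntercept_pursuitVelocity {μ : ℝ} (hμ : μ < 1) {q : E3 × E3 × E3}
    (hq : q ∈ pursuitStates μ) :
    UnitIntercept (‖q.1‖⁻¹ • q.1) q.2.1 q.2.2 (pursuitVelocity μ q) (interceptTime q) := by
  obtain ⟨hI, h⟩ := interceptTime_spec hq
  have hIoo := interceptTime_mem_Ioo hμ hq
  have hs := Real.sin_pos_of_pos_of_lt_pi hIoo.1 hIoo.2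
  rw [pursuitVelocity_of_mem hq]
  obtain ⟨⟨⟨hp0, he0⟩, hα0, hα1⟩, he, hwe, hw⟩ := hq
  simp only at *
  set τ := interceptTime q
  have hp1 : ‖‖q.1‖⁻¹ • q.1‖ = 1 := by
    rw [norm_smul, norm_inv, norm_norm, inv_mul_cancel₀ (norm_ne_zero_iff.2 hp0)]
  have hn := norm_geodesicArc he hwe τ
  have hin : inner ℝ (geodesicArc q.2.1 q.2.2 τ) (‖q.1‖⁻¹ • q.1) = Real.cos τ := by
    rw [inner_eq_cos_angle hn hp1, angle_smul_right_of_pos _ _ (by positivity), h]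
  set p := ‖q.1‖⁻¹ • q.1
  set y := geodesicArc q.2.1 q.2.2 τ
  refine ⟨hp1, he, ?_, ?_, hwe, hI.1, hI.2, ?_, ?_⟩
  · rw [norm_smul, Real.norm_of_nonneg (inv_nonneg.2 hs.le), inv_mul_eq_one₀ hs.ne',
      ← sq_eq_sq₀ hs.le (norm_nonneg _), norm_sub_sq_real, hn, norm_smul, hp1,
      real_inner_smul_right, hin, Real.norm_eq_abs, mul_one, sq_abs, Real.sin_sq]
    ring
  · rw [real_inner_smul_left, inner_sub_left, real_inner_smul_left, hin,
      real_inner_self_eq_norm_sq, hp1]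
    ring
  · nlinarith [hI.1, hI.2]
  · change y = _
    rw [smul_inv_smul₀ hs.ne']
    abel

theorem norm_pursuitVelocity_le {μ : ℝ} (hμ : μ < 1) (q : E3 × E3 × E3) :
    ‖pursuitVelocity μ q‖ ≤ 1 := by
  by_cases hq : q ∈ pursuitStates μ
  · exact (unitIntercept_pursuitVelocity hμ hq).norm_v.le
  · simp [pursuitVelocity_of_notMem hq]

theorem inner_pursuitVelocity {μ : ℝ} (hμ : μ < 1) (q : E3 × E3 × E3) :
    inner ℝ q.1 (pursuitVelocity μ q) = 0 := by
  by_cases hq : q ∈ pursuitStates μ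
  · have h := (unitIntercept_pursuitVelocity hμ hq).inner_vp
    rw [real_inner_smul_right] at h
    rw [real_inner_comm]
    exact (mul_eq_zero.1 h).resolve_left (inv_ne_zero (norm_ne_zero_iff.2 hq.1.1.1))
  · simp [pursuitVelocity_of_notMem hq]

/-- For fixed `e` and `w` the admissible positions form an open set, because the pursuer is not
confined to the unit sphere, which Euler polygons may leave. Relative continuity is therefore full
continuity, as `exists_integral_solution` demands. -/
theorem continuousAt_pursuitVelocity {μ : ℝ} (hμ : μ < 1) {p e w : E3}
    (hq : (p, e, w) ∈ pursuitStates μ) :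
    ContinuousAt (fun x => pursuitVelocity μ (x, e, w)) p := by
  refine (continuousOn_pursuitVelocity hμ (p, e, w) hq).tendsto.comp ?_
  refine tendsto_nhdsWithin_iff.2 ⟨Continuous.tendsto (by fun_prop) p, ?_⟩
  have hopen : IsOpen {x : E3 | (x, e) ∈ pursuitPositions μ} :=
    (isOpen_pursuitPositions μ).preimage (by fun_prop)
  filter_upwards [hopen.mem_nhds hq.1] with x hx
  exact ⟨hx, hq.2⟩

/-! ### Existence of a pursuer motion that follows the strategy -/

theorem IsMotion.ae_differentiableAt {R c : ℝ} {X₀ : E3} {X : ℝ → E3} (h : IsMotion R c X₀ X)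
    (hc : 0 ≤ c) : ∀ᵐ t : ℝ, 0 < t → DifferentiableAt ℝ X t := by
  have hlip : LipschitzWith (Real.toNNReal c) (fun t => X (max t 0)) :=
    LipschitzWith.of_dist_le_mul fun s t => by
      rw [Real.coe_toNNReal _ hc]
      refine (h.dist_le (le_max_right _ _) (le_max_right _ _)).trans
        (mul_le_mul_of_nonneg_left ?_ hc)
      exact abs_max_sub_max_le_abs s t 0
  filter_upwards [hlip.ae_differentiableAt] with t ht ht0
  refine ht.congr_of_eventuallyEq ?_
  filter_upwards [Ioi_mem_nhds ht0] with s hs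
  rw [max_eq_left (le_of_lt hs)]

theorem IsMotion.continuous_extend {R c : ℝ} {X₀ : E3} {X : ℝ → E3} (h : IsMotion R c X₀ X)
    (hc : 0 ≤ c) : Continuous fun t => X (max t 0) :=
  (LipschitzWith.of_dist_le_mul (K := Real.toNNReal c) fun s t => by
      rw [Real.coe_toNNReal _ hc]
      exact (h.dist_le (le_max_right _ _) (le_max_right _ _)).trans
        (mul_le_mul_of_nonneg_left (abs_max_sub_max_le_abs s t 0) hc)).continuous

/-- An integral solution of `x' = F t x` with `F t x` orthogonal to `x` stays on the sphere, and
satisfies the equation almost everywhere. -/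
theorem integral_solution_properties {F : ℝ → E3 → E3} {M : ℝ}
    (hF : Measurable (Function.uncurry F)) (hM : ∀ t x, ‖F t x‖ ≤ M)
    (horth : ∀ t x, inner ℝ x (F t x) = 0) {x₀ : E3} {X : ℝ → E3} (hX : Continuous X)
    {T : ℝ} (hint : ∀ t ∈ Icc 0 T, X t = x₀ + ∫ s in 0..t, F s (X s)) :
    (∀ᵐ t : ℝ, t ∈ Ioo 0 T → HasDerivAt X (F t (X t)) t) ∧ ∀ t ∈ Icc 0 T, ‖X t‖ = ‖x₀‖ := by
  have hg : Measurable fun s => F s (X s) := hF.comp (measurable_id.prodMk hX.measurable)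
  have hloc : LocallyIntegrable (fun s => F s (X s)) :=
    locallyIntegrable_const M |>.mono hg.aestronglyMeasurable
      (Eventually.of_forall fun s => (hM _ _).trans (le_abs_self M))
  have hder : ∀ᵐ t : ℝ, t ∈ Ioo 0 T → HasDerivAt X (F t (X t)) t := by
    filter_upwards [_root_.LocallyIntegrable.ae_hasDerivAt_integral hloc] with t ht htT
    refine ((ht 0).const_add x₀).congr_of_eventuallyEq ?_
    filter_upwards [Ioo_mem_nhds htT.1 htT.2] with s hs
    exact hint s ⟨hs.1.le, hs.2.le⟩
  refine ⟨hder, fun t ht => ?_⟩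
  have hM0 : 0 ≤ M := (norm_nonneg _).trans (hM 0 x₀)
  have hsub : uIcc 0 t ⊆ Icc 0 T := by
    rw [uIcc_of_le ht.1]; exact Icc_subset_Icc_right ht.2
  have hlipX : LipschitzOnWith (Real.toNNReal M) X (uIcc 0 t) :=
    LipschitzOnWith.of_dist_le_mul fun s hs u hu => by
      rw [Real.coe_toNNReal _ hM0, dist_eq_norm, hint s (hsub hs), hint u (hsub hu),
        add_sub_add_left_eq_sub]
      exact norm_integral_sub_le hg (fun s => hM _ _) 0 s u
  have hlipn : AbsolutelyContinuousOnInterval (fun s => ‖X s‖) 0 t :=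
    ((lipschitzWith_one_norm (E := E3)).comp_lipschitzOnWith hlipX).absolutelyContinuousOnInterval
  have hsq := hlipn.mul hlipn
  have hd : ∀ᵐ s : ℝ, s ∈ Ioo 0 t → HasDerivAt (fun s => ‖X s‖ * ‖X s‖) 0 s := by
    filter_upwards [hder] with s hs hst
    have h1 := (hs ⟨hst.1, hst.2.trans_le ht.2⟩).norm_sq
    rw [horth, mul_zero] at h1
    simpa only [sq] using h1
  -- The squared norm has zero derivative almost everywhere; applying monotonicity to it and to its
  -- negative shows that it is constant.
  have h1 := AbsolutelyContinuousOnInterval.le_of_ae_deriv_nonneg (f := fun s => ‖X s‖ * ‖X s‖)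
    ht.1 hsq (by filter_upwards [hd] with s hs hst using ⟨0, hs hst, le_rfl⟩)
  have h2 := AbsolutelyContinuousOnInterval.le_of_ae_deriv_nonneg
    (f := fun s => -(‖X s‖ * ‖X s‖)) ht.1 hsq.neg
    (by filter_upwards [hd] with s hs hst using ⟨_, (hs hst).neg, by simp⟩)
  have h0 : X 0 = x₀ := by simpa using hint 0 ⟨le_rfl, ht.1.trans ht.2⟩
  rw [h0] at h1 h2
  rw [← sq_eq_sq₀ (norm_nonneg _) (norm_nonneg _)]
  nlinarith

theorem exists_geodesicParallelResponse {R vP μ : ℝ} (hR : 0 < R) (hvP : 0 < vP) (hμ0 : 0 < μ)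
    (hμ : μ < 1) {P₀ E₀ : E3} (hP₀ : ‖P₀‖ = R)
    (hα : angDist P₀ E₀ ≤ (1 - μ) / (1 + μ) * Real.pi) {E : ℝ → E3}
    (hE : IsMotion R (μ * vP) E₀ E) : ∃ P, IsGeodesicParallelResponse R vP P₀ E P := by
  have hpi := Real.pi_pos
  have hμv : 0 ≤ μ * vP := by positivity
  have hκ : 0 < vP / R := by positivity
  set κ := vP / R with hκdef
  -- Motions are controlled for `t ≥ 0` only; freezing the evader at negative times makes `e`
  -- continuous on the whole line.
  set e : ℝ → E3 := fun t => R⁻¹ • E (max t 0) with he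
  set w : ℝ → E3 := fun t => vP⁻¹ • deriv (fun s => E (max s 0)) t with hw
  set F : ℝ → E3 → E3 := fun t x => κ • pursuitVelocity μ (x, e t, w t) with hFdef
  have hecont : Continuous e := (hE.continuous_extend hμv).const_smul R⁻¹
  have hF : Measurable (Function.uncurry F) := by
    have hwm : Measurable w := (measurable_deriv _).const_smul vP⁻¹
    refine ((measurable_pursuitVelocity hμ).comp
      (measurable_snd.prodMk ((hecont.measurable.comp measurable_fst).prodMk
        (hwm.comp measurable_fst)))).const_smul κ
  have hM : ∀ t x, ‖F t x‖ ≤ κ := fun t x => by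
    rw [hFdef, norm_smul, Real.norm_of_nonneg hκ.le]
    exact mul_le_of_le_one_right hκ.le (norm_pursuitVelocity_le hμ _)
  have horth : ∀ t x, inner ℝ x (F t x) = 0 := fun t x => by
    simp only [hFdef]
    rw [real_inner_smul_right, inner_pursuitVelocity hμ (x, e t, w t), mul_zero]
  have hB : 0 < captureBound R vP μ := by
    have := approachSpeed_pos hμ0 hμ
    unfold captureBound
    positivity
  obtain ⟨X, hX0, hXlip, hXint⟩ := exists_integral_solution hF hM (R⁻¹ • P₀)
    (show 0 ≤ captureBound R vP μ + 1 by linarith)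
  set T := captureBound R vP μ + 1 with hT
  have hXcont : Continuous X :=
    (LipschitzWith.of_dist_le_mul (K := Real.toNNReal κ) fun s t => by
      rw [Real.coe_toNNReal _ hκ.le, dist_eq_norm]; exact hXlip s t).continuous
  have hderivE : ∀ᵐ t : ℝ, 0 < t → HasDerivAt E (vP • w t) t := by
    filter_upwards [hE.ae_differentiableAt hμv] with t ht ht0
    have heq : (fun s => E (max s 0)) =ᶠ[𝓝 t] E := by
      filter_upwards [Ioi_mem_nhds ht0] with s hs
      rw [max_eq_left (le_of_lt hs)]
    simp only [hw]
    rw [smul_inv_smul₀ hvP.ne', heq.deriv_eq]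
    exact (ht ht0).hasDerivAt
  have hstate : ∀ᵐ t : ℝ, 0 < t → (X t, e t) ∈ pursuitPositions μ →
      (X t, e t, w t) ∈ pursuitStates μ := by
    filter_upwards [hderivE] with t ht ht0 hpos
    have hd := ht ht0
    have het : e t = R⁻¹ • E t := by simp only [he, max_eq_left ht0.le]
    refine ⟨hpos, ?_, ?_, ?_⟩
    · rw [het]; exact norm_inv_smul_eq_one hR (hE.norm_eq ht0.le)
    · have := hE.inner_deriv ht0 hd
      rw [real_inner_smul_left] at this
      simp only [het]
      rw [real_inner_smul_right, (mul_eq_zero.1 this).resolve_left hvP.ne', mul_zero]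
    · have := hE.norm_deriv_le hμv ht0 hd
      rw [norm_smul, Real.norm_of_nonneg hvP.le, mul_comm] at this
      exact le_of_mul_le_mul_right this hvP
  -- until positions become degenerate, `R • X` follows the strategy
  have hgood : ∀ t₁, 0 ≤ t₁ → t₁ ≤ T → (∀ t ∈ Ico 0 t₁, (X t, e t) ∈ pursuitPositions μ) →
      IsMotion R vP P₀ (fun t => R • X (min (max t 0) t₁)) ∧
      (∀ t ∈ Ico 0 t₁, R • X (min (max t 0) t₁) ≠ E t) ∧
      ∀ᵐ t : ℝ, t ∈ Ioo 0 t₁ → ∃ w v : E3, HasDerivAt E w t ∧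
        HasDerivAt (fun t => R • X (min (max t 0) t₁)) v t ∧
        IsGeodesicParallelVelocity R vP (R • X (min (max t 0) t₁)) (E t) w v := by
    intro t₁ h0 h1 hpos
    have hint : ∀ t ∈ Icc 0 t₁, X t = R⁻¹ • P₀ + ∫ s in 0..t, F s (X s) := by
      intro t ht
      refine hXint t ⟨ht.1, ht.2.trans h1⟩ ?_
      filter_upwards [hstate] with s hs hst
      have := hs hst.1 (hpos s ⟨hst.1.le, hst.2.trans_le ht.2⟩)
      exact (continuousAt_pursuitVelocity hμ this).const_smul κ
    obtain ⟨hder, hnorm⟩ := integral_solution_properties hF hM horth hXcont hint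
    rw [norm_inv_smul_eq_one hR hP₀] at hnorm
    have hcl : ∀ t, min (max t 0) t₁ ∈ Icc 0 t₁ := fun t =>
      ⟨le_min (le_max_right _ _) h0, min_le_right _ _⟩
    have hcl' : ∀ t ∈ Icc 0 t₁, min (max t 0) t₁ = t := fun t ht => by
      rw [max_eq_left ht.1, min_eq_left ht.2]
    refine ⟨⟨?_, ?_, ?_⟩, ?_, ?_⟩
    · simp only [hcl' 0 ⟨le_rfl, h0⟩, hX0, smul_inv_smul₀ hR.ne']
    · intro t _
      rw [mem_sphere_zero_iff_norm, norm_smul, hnorm _ (hcl t), Real.norm_of_nonneg hR.le, mul_one]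
    · intro s t hs hst
      rw [dist_eq_norm, ← smul_sub, norm_smul, Real.norm_of_nonneg hR.le]
      have h2 := hXlip (min (max s 0) t₁) (min (max t 0) t₁)
      have h3 : |min (max s 0) t₁ - min (max t 0) t₁| ≤ t - s := by
        refine (abs_min_sub_min_le_max _ _ _ _).trans ?_
        rw [sub_self, abs_zero]
        refine max_le ((abs_max_sub_max_le_abs s t 0).trans ?_) (by linarith)
        rw [abs_sub_comm, abs_of_nonneg (by linarith)]
      have h4 := mul_le_mul_of_nonneg_left (h2.trans (mul_le_mul_of_nonneg_left h3 hκ.le)) hR.le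
      refine h4.trans (le_of_eq ?_)
      rw [hκdef]; field_simp
    · intro t ht heq
      have hpt := (hpos t ht).2.1
      rw [hcl' t ⟨ht.1, ht.2.le⟩] at heq
      simp only [he, max_eq_left ht.1, ← heq, inv_smul_smul₀ hR.ne'] at hpt
      rw [angle_self (hpos t ht).1.1] at hpt
      exact lt_irrefl _ hpt
    · filter_upwards [hder, hderivE, hstate] with t h2 h3 h4 ht
      have ht' : t ∈ Icc 0 t₁ := ⟨ht.1.le, ht.2.le⟩
      have hst := h4 ht.1 (hpos t ⟨ht.1.le, ht.2⟩)
      refine ⟨vP • w t, vP • pursuitVelocity μ (X t, e t, w t), h3 ht.1, ?_, ?_⟩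
      · have hd := (h2 ht).fun_const_smul R
        have e1 : R • F t (X t) = vP • pursuitVelocity μ (X t, e t, w t) := by
          rw [hFdef, smul_smul]; congr 1; rw [hκdef]; field_simp
        rw [e1] at hd
        refine hd.congr_of_eventuallyEq ?_
        filter_upwards [Ioo_mem_nhds ht.1 ht.2] with s hs
        rw [hcl' s ⟨hs.1.le, hs.2.le⟩]
      · have hU := unitIntercept_pursuitVelocity hμ hst
        simp only [hnorm t ht', inv_one, one_smul] at hU
        rw [hcl' t ht']
        refine UnitIntercept.isGeodesicParallelVelocity (τ := interceptTime (X t, e t, w t))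
          hR hvP ?_
        rw [inv_smul_smul₀ hR.ne', inv_smul_smul₀ hvP.ne']
        have het : e t = R⁻¹ • E t := by simp only [he, max_eq_left ht.1.le]
        rw [← het]
        exact hU
  have hpursuit : ∀ t₁, 0 ≤ t₁ → t₁ ≤ T → (∀ t ∈ Ico 0 t₁, (X t, e t) ∈ pursuitPositions μ) →
      t₁ ≤ captureBound R vP μ ∧ ‖X t₁‖ = 1 ∧
        angle (X t₁) (e t₁) ≤ (1 - μ) / (1 + μ) * Real.pi := by
    intro t₁ h0 h1 hpos
    obtain ⟨g1, g2, g3⟩ := hgood t₁ h0 h1 hpos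
    have hU := unitPursuit_of_strategy hR hvP hμ0 hμ g1 hE g2 g3
    have hα0 : angle (R⁻¹ • R • X (min (max 0 0) t₁)) (R⁻¹ • E 0) ≤
        (1 - μ) / (1 + μ) * Real.pi := by
      have := g1.init
      rw [angle_inv_smul hR, this, hE.init]
      exact hα
    have h3 := hU.angle_le hκ hμ0 hμ hα0 (t := t₁) ⟨h0, le_rfl⟩
    have h4 := hU.norm_p t₁ ⟨h0, le_rfl⟩
    simp only [max_eq_left h0, min_self, inv_smul_smul₀ hR.ne'] at h3 h4
    refine ⟨hU.le_captureBound hR hvP hμ0 hμ h0 hα0, h4, ?_⟩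
    simp only [he, max_eq_left h0]
    exact h3
  set B := Icc 0 T ∩ (fun t => (X t, e t)) ⁻¹' (pursuitPositions μ)ᶜ with hBdef
  have hBclosed : IsClosed B := isClosed_Icc.inter
    ((isOpen_pursuitPositions μ).isClosed_compl.preimage (hXcont.prodMk hecont))
  have hBcompact : IsCompact B := isCompact_Icc.of_isClosed_subset hBclosed inter_subset_left
  -- Positions that stayed nondegenerate up to `T = captureBound R vP μ + 1` would give `T ≤
  -- captureBound R vP μ`.
  have hBne : B.Nonempty := by
    by_contra hemp
    have := (hpursuit T (by linarith) le_rfl fun t ht => by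
      by_contra hcon
      exact hemp ⟨t, ⟨ht.1, ht.2.le⟩, hcon⟩).1
    linarith
  have hmem := hBcompact.sInf_mem hBne
  set t₁ := sInf B
  have hpos : ∀ t ∈ Ico 0 t₁, (X t, e t) ∈ pursuitPositions μ := by
    intro t ht
    by_contra hcon
    exact absurd (csInf_le hBcompact.bddBelow
      (⟨⟨ht.1, ht.2.le.trans hmem.1.2⟩, hcon⟩ : t ∈ B)) (not_le.2 ht.2)
  obtain ⟨g1, g2, g3⟩ := hgood t₁ hmem.1.1 hmem.1.2 hpos
  obtain ⟨-, hn, ha⟩ := hpursuit t₁ hmem.1.1 hmem.1.2 hpos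
  have hen : ‖e t₁‖ = 1 := by
    simp only [he, max_eq_left hmem.1.1]
    exact norm_inv_smul_eq_one hR (hE.norm_eq hmem.1.1)
  -- At `t₁` both vectors are nonzero and the angle is still below `(1 - μ) * π`, so the position
  -- can only be degenerate because the angle is zero.
  have hcap : X t₁ = e t₁ := by
    refine eq_of_angle_eq_zero_of_norm_eq ?_ (hn.trans hen.symm)
    by_contra hne
    refine hmem.2 ⟨⟨?_, ?_⟩, (angle_nonneg _ _).lt_of_ne' hne,
      ha.trans_lt (angular_bound_lt hμ0 hμ)⟩
    · exact norm_ne_zero_iff.1 (by simp only [hn]; exact one_ne_zero)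
    · exact norm_ne_zero_iff.1 (by simp only [hen]; exact one_ne_zero)
  -- The pursuer rests after the capture at `t₁`, where the strategy prescribes nothing.
  refine ⟨fun t => R • X (min (max t 0) t₁), g1, ?_⟩
  filter_upwards [g3] with t ht ht0 hfree
  refine ht ⟨ht0, ?_⟩
  by_contra hcon
  refine hfree t₁ ⟨hmem.1.1, not_lt.1 hcon⟩ ?_
  simp only [max_eq_left hmem.1.1, min_self, hcap, he, smul_inv_smul₀ hR.ne']

end

theorem mainTheorem5 (R vP μ : ℝ) (hR : 0 < R) (hvP : 0 < vP) (hμ0 : 0 < μ) (hμ1 : μ < 1)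
    (T : Set E3) (hT : T ⊆ Metric.sphere (0 : E3) R)
    (P₀ E₀ : E3) (hP₀ : P₀ ∈ Metric.sphere (0 : E3) R) (hE₀ : E₀ ∈ Metric.sphere (0 : E3) R)
    (hne : P₀ ≠ E₀)
    (hdisj : apolloniusDomain R vP μ P₀ E₀ ∩ T = ∅)
    (hα : angDist P₀ E₀ ≤ (1 - μ) / (1 + μ) * Real.pi) :
    ∃ tmax : ℝ, ∀ E : ℝ → E3, IsMotion R (μ * vP) E₀ E →
      (∃ P : ℝ → E3, IsGeodesicParallelResponse R vP P₀ E P) ∧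
      ∀ P : ℝ → E3, IsGeodesicParallelResponse R vP P₀ E P →
        ∃ tc : ℝ, IsCaptureTime P E tc ∧ tc ≤ tmax ∧
          (∀ t, 0 ≤ t → t ≤ tc → E t ∉ T) ∧
          (∀ s t, 0 ≤ s → s ≤ t → t ≤ tc →
            apolloniusDomain R vP μ (P t) (E t) ⊆ apolloniusDomain R vP μ (P s) (E s)) := by
  refine ⟨captureBound R vP μ, fun E hE => ⟨exists_geodesicParallelResponse hR hvP hμ0 hμ1
    (mem_sphere_zero_iff_norm.1 hP₀) hα hE, fun P hP => ?_⟩⟩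
  obtain ⟨tc, htc, hle, hmono⟩ := exists_capture hR hvP hμ0 hμ1 hα hE hP
  refine ⟨tc, htc, hle, fun t ht0 ht hET => ?_, hmono⟩
  have h1 := hmono 0 t le_rfl ht0 ht (mem_apolloniusDomain_self hR hvP hμ0 (hE.norm_eq ht0))
  rw [hP.motion.init, hE.init] at h1
  exact (eq_empty_iff_forall_notMem.1 hdisj) (E t) ⟨h1, hET⟩
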